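/- Let $X$ be a complex Banach space, $\mathcal B(X)$ the bounded linear operators on $X$ and $\mathcal F(X)$ those of finite rank. For $F\in\mathcal F(X)$ with range $R$ and restriction $F_R:R\to R$ put $\det(I-F)=\det(I_R-F_R)$, $\operatorname{tr}(F)=\operatorname{tr}(F_R)$ and, for $p>0$, $\det_p(I-F)=\det(I-F)\exp\Big(\sum_{k=1}^{\lceil p\rceil-1}\frac1k\operatorname{tr}(F^k)\Big)$. Let $p>0$. An *$l_p$-ideal* in $\mathcal B(X)$ is a linear subspace $\mathcal I\subset\mathcal B(X)$ with a quasi-norm $\|\cdot\|_{\mathcal I}$ (a norm, except that the triangle inequality is only required in the form $\|K+L\|_{\mathcal I}\le q(\|K\|_{\mathcal I}+\|L\|_{\mathcal I})$ for some constant $q\ge1$) such that: $\mathcal F(X)$ is contained and dense in $(\mathcal I,\|\cdot\|_{\mathcal I})$; $\|L\|\le\|L\|_{\mathcal I}$ for $L\in\mathcal I$; if $L\in\mathcal I$ and $A,B\in\mathcal B(X)$ then $ALB\in\mathcal I$ and $\|ALB\|_{\mathcal I}\le\|A\|\,\|L\|_{\mathcal I}\,\|B\|$; and there is a constant $\gamma_p$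 such that $\big(\sum_j|\lambda_j(L)|^p\big)^{1/p}\le\gamma_p\|L\|_{\mathcal I}$ for all $L\in\mathcal I$, where $(\lambda_j(L))$ are the discrete eigenvalues of $L$ (isolated eigenvalues with Riesz projection of finite rank), each repeated according to its algebraic multiplicity (the rank of the Riesz projection). **Proposition 4.7.** Let $p>0$ and let $(\mathcal I,\|\cdot\|_{\mathcal I})$ be an $l_p$-ideal in $\mathcal B(X)$. Then there is exactly one function $L\mapsto\det_{p,\mathcal I}(I-L)$ from $\mathcal I$ to $\mathbb C$ that is continuous with respect to $\|\cdot\|_{\mathcal I}$ and satisfies $\det_{p,\mathcal I}(I-F)=\det_p(I-F)$ for all $F\in\mathcal F(X)$. Moreover, for all $L\in\mathcal I$, $F\in\mathcal F(X)$ and $B\in\mathcal B(X)$: (i) $\det_{p,\mathcal I}(I-LB)=\det_{p,\mathcal I}(I-BL)$. (ii) If $H:=F+L-FL$, so that $(I-F)(I-L)=I-H$ and $H\in\mathcal I$, then $$\det\nolimits_{p,\mathcal I}((I-F)(I-L))=\det(I-F)\,\det\nolimits_{p,\mathcal I}(I-L)\,\exp\Big(\sum_{k=1}^{\lceil p\rceil-1}\sum_{m=0}^{k-1}\frac{\operatorname{tr}\big(F(I-L)L^mH^{k-1-m}\big)}{k}\Big).$$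 (iii) $\det_{p,\mathcal I}(I-L)\ne0$ if and only if $I-L$ is invertible in $\mathcal B(X)$. -/

import Mathlib

noncomputable section

namespace RegDet

variable {X : Type*} [NormedAddCommGroup X] [NormedSpace ℂ X]

/-! ### Finite rank operators, their determinant and trace -/

/-- The bounded operator `F` has finite rank: its range is finite-dimensional. -/
def FiniteRank (F : X →L[ℂ] X) : Prop :=
  FiniteDimensional ℂ (LinearMap.range (F : X →ₗ[ℂ] X))

/-- The restriction `F_R : R → R` of `F` to its own range `R`. -/
def onRange (F : X →L[ℂ] X) :
    LinearMap.range (F : X →ₗ[ℂ] X) →ₗ[ℂ] LinearMap.range (F : X →ₗ[ℂ] X) :=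
  (F : X →ₗ[ℂ] X).restrict (fun x _ => LinearMap.mem_range_self _ x)

/-- `det (I - F) := det (I_R - F_R)` for `F` of finite rank with range `R`. -/
def detOneSub (F : X →L[ℂ] X) : ℂ := LinearMap.det (1 - onRange F)

/-- `tr F := tr F_R` for `F` of finite rank with range `R`. -/
def tr (F : X →L[ℂ] X) : ℂ := LinearMap.trace ℂ _ (onRange F)

/-- `det_p (I - F) = det (I - F) * exp (∑_{k=1}^{⌈p⌉-1} tr (F^k) / k)` for `F` of finite rank. -/
def regDetFin (p : ℝ) (F : X →L[ℂ] X) : ℂ :=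
  detOneSub F * Complex.exp (∑ k ∈ Finset.Ico 1 ⌈p⌉₊, tr (F ^ k) / (k : ℂ))

/-! ### Discrete eigenvalues and algebraic multiplicity -/

/-- The closed disc of radius `r > 0` around `z` contains no point of the spectrum of `Z` apart
from (possibly) `z`. -/
def IsIsolatingRadius (Z : X →L[ℂ] X) (z : ℂ) (r : ℝ) : Prop :=
  0 < r ∧ spectrum ℂ Z ∩ Metric.closedBall z r ⊆ {z}

open Classical in
/-- The Riesz projection `(2πi)⁻¹ ∮ (μ - Z)⁻¹ dμ` over a circle around `z` of any radius that is
small enough to exclude the rest of the spectrum (and `0` if there is no such radius). -/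
def rieszProjection (Z : X →L[ℂ] X) (z : ℂ) : X →L[ℂ] X :=
  if h : ∃ r, IsIsolatingRadius Z z r then
    (2 * Real.pi * Complex.I : ℂ)⁻¹ • ∮ μ in C(z, h.choose), resolvent Z μ
  else 0

/-- The algebraic multiplicity of an isolated eigenvalue: the rank of its Riesz projection. -/
def algMult (Z : X →L[ℂ] X) (z : ℂ) : ℕ :=
  Module.finrank ℂ (LinearMap.range (rieszProjection Z z : X →ₗ[ℂ] X))

/-- The discrete spectrum: the eigenvalues that are isolated points of the spectrum and have
finite algebraic multiplicity. -/
def discreteSpectrum (Z : X →L[ℂ] X) : Set ℂ :=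
  {z | Module.End.HasEigenvalue (Z : X →ₗ[ℂ] X) z ∧ (∃ r, IsIsolatingRadius Z z r) ∧
    FiniteRank (rieszProjection Z z)}

open scoped ENNReal in
/-- `‖(λ_j(L))‖_{l_p} = (∑_j |λ_j(L)|^p)^{1/p}`, a value in `[0, ∞]`, where `(λ_j(L))` lists the
discrete eigenvalues of `L`, each repeated according to its algebraic multiplicity. -/
def eigenvalueLpNorm (p : ℝ) (L : X →L[ℂ] X) : ℝ≥0∞ :=
  (∑' z : discreteSpectrum L, (algMult L z : ℝ≥0∞) * ENNReal.ofReal (‖(z : ℂ)‖ ^ p)) ^ (1 / p)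

/-! ### Quasi-norms and `l_p`-ideals -/

/-- `N` is a quasi-norm on the complex vector space `V`. -/
structure IsQuasiNorm {V : Type*} [AddCommGroup V] [Module ℂ V] (N : V → ℝ) : Prop where
  nonneg : ∀ x, 0 ≤ N x
  eq_zero_iff : ∀ x, N x = 0 ↔ x = 0
  quasi_triangle : ∃ q : ℝ, 1 ≤ q ∧ ∀ x y, N (x + y) ≤ q * (N x + N y)
  smul : ∀ (c : ℂ) (x : V), N (c • x) = ‖c‖ * N x

/-- Continuity of `D : V → ℂ` for the topology that the quasi-norm `N` induces on `V`, in which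
the sets `{y | N (y - x) < δ}`, `δ > 0`, form a base of neighbourhoods of `x`. -/
def QuasiContinuous {V : Type*} [AddCommGroup V] (N : V → ℝ) (D : V → ℂ) : Prop :=
  ∀ x : V, ∀ ε : ℝ, 0 < ε → ∃ δ : ℝ, 0 < δ ∧ ∀ y : V, N (y - x) < δ → ‖D y - D x‖ < ε

open scoped NNReal ENNReal in
/-- `(𝓘, N)` is an `l_p`-ideal in `B(X)`. -/
structure IsLpIdeal (p : ℝ) (𝓘 : Submodule ℂ (X →L[ℂ] X)) (N : 𝓘 → ℝ) : Prop where
  quasiNorm : IsQuasiNorm N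
  /-- The finite rank operators belong to `𝓘` ... -/
  finiteRank_mem : ∀ F : X →L[ℂ] X, FiniteRank F → F ∈ 𝓘
  /-- ... and are dense in it with respect to `N`. -/
  dense : ∀ (L : 𝓘) (ε : ℝ), 0 < ε → ∃ F : 𝓘, FiniteRank (F : X →L[ℂ] X) ∧ N (F - L) < ε
  opNorm_le : ∀ L : 𝓘, ‖(L : X →L[ℂ] X)‖ ≤ N L
  mul_mul_mem : ∀ (A : X →L[ℂ] X) (L : 𝓘) (B : X →L[ℂ] X), A * (L : X →L[ℂ] X) * B ∈ 𝓘
  norm_mul_mul_le : ∀ (A : X →L[ℂ] X) (L : 𝓘) (B : X →L[ℂ] X),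
    N ⟨A * (L : X →L[ℂ] X) * B, mul_mul_mem A L B⟩ ≤ ‖A‖ * N L * ‖B‖
  /-- Eigenvalue type `l_p`, with some eigenvalue constant `γ`. -/
  eigenvalue_le : ∃ γ : ℝ≥0, ∀ L : 𝓘,
    eigenvalueLpNorm p (L : X →L[ℂ] X) ≤ (γ : ℝ≥0∞) * ENNReal.ofReal (N L)

/-- `D`, thought of as `L ↦ det_{p,𝓘} (I - L)`, is a continuous function on `(𝓘, N)` that agrees
with `F ↦ det_p (I - F)` on the finite rank operators. -/
structure IsRegDet (p : ℝ) (𝓘 : Submodule ℂ (X →L[ℂ] X)) (N : 𝓘 → ℝ) (D : 𝓘 → ℂ) : Prop where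
  continuous : QuasiContinuous N D
  extends_fin : ∀ F : 𝓘, FiniteRank (F : X →L[ℂ] X) → D F = regDetFin p (F : X →L[ℂ] X)

open Classical in
/-- The `p`-regularized determinant `L ↦ det_{p,𝓘} (I - L)`: the continuous extension of
`F ↦ det_p (I - F)` from the finite rank operators to `(𝓘, N)` (and `0` if there is none). -/
def regDet (p : ℝ) (𝓘 : Submodule ℂ (X →L[ℂ] X)) (N : 𝓘 → ℝ) : 𝓘 → ℂ :=
  if h : ∃ D : 𝓘 → ℂ, IsRegDet p 𝓘 N D then h.choose else 0

variable {p : ℝ} {𝓘 : Submodule ℂ (X →L[ℂ] X)} {N : 𝓘 → ℝ}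

theorem IsLpIdeal.mul_right_mem (h : IsLpIdeal p 𝓘 N) (L : 𝓘) (B : X →L[ℂ] X) :
    (L : X →L[ℂ] X) * B ∈ 𝓘 := by
  simpa using h.mul_mul_mem 1 L B

theorem IsLpIdeal.mul_left_mem (h : IsLpIdeal p 𝓘 N) (B : X →L[ℂ] X) (L : 𝓘) :
    B * (L : X →L[ℂ] X) ∈ 𝓘 := by
  simpa using h.mul_mul_mem B L 1

/-- `I - (I - F)(I - L) = F + L - FL` belongs to `𝓘` for `F` of finite rank and `L ∈ 𝓘`. -/
theorem IsLpIdeal.one_sub_mul_mem (h : IsLpIdeal p 𝓘 N) {F : X →L[ℂ] X} (hF : FiniteRank F)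
    (L : 𝓘) : 1 - (1 - F) * (1 - (L : X →L[ℂ] X)) ∈ 𝓘 := by
  have e : 1 - (1 - F) * (1 - (L : X →L[ℂ] X)) = F + L - F * L := by noncomm_ring
  rw [e]
  exact 𝓘.sub_mem (𝓘.add_mem (h.finiteRank_mem F hF) L.2) (h.mul_left_mem F L)

end RegDet

end

noncomputable section

namespace RegDet

open Module

/-! ### Sylvester's identity and sums over the roots of the characteristic polynomial -/

section FiniteDimensional

variable {V W : Type*} [AddCommGroup V] [Module ℂ V] [FiniteDimensional ℂ V]
  [AddCommGroup W] [Module ℂ W] [FiniteDimensional ℂ W]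

/-! For `F` of finite rank, `det_p (I - F)` is the product of the elementary factors `elemFactor
⌈p⌉₊` over the eigenvalues of `F` on its range. Each factor is at most `exp (C |z|^p)` in modulus,
so the eigenvalue condition bounds `det_p (I - F)` in terms of `N F` alone.

Along a line `B + z (A - B)` of finite rank operators the determinant is entire in `z`. The Schwarz
lemma turns the bound into a Lipschitz estimate on bounded sets (`IsLpIdeal.exists_lipschitz`), and
density of the finite rank operators then gives existence and uniqueness of the extension
(`IsQuasiNorm.exists_extension`, `QuasiContinuous.eq_of_dense`). Identities (i) and (ii) hold for
finite rank by linear algebra on a common finite-dimensional subspace and pass to `𝓘` by continuity.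

For (iii), the elementary factors also satisfy a lower bound for `|z| ≤ 1/2`, so the determinant
does not vanish near `L = 0`. For general `L`, choose `F₀` of finite rank close to `L` and factor `I
- L = (I - F₀ v)(I - (L - F₀))` with `v = (I - (L - F₀))⁻¹`. By (ii), both nonvanishing and
invertibility reduce to `det (I - F₀ v) ≠ 0`.

The eigenvalue condition is phrased with Riesz projections, so these must be compared with the roots
of the characteristic polynomial (`rootMultiplicity_le_algMult`). -/

theorem det_one_sub_comp_comm (f : V →ₗ[ℂ] W) (g : W →ₗ[ℂ] V) :
    LinearMap.det (1 - g ∘ₗ f) = LinearMap.det (1 - f ∘ₗ g) := by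
  classical
  let b := finBasis ℂ V
  let c := finBasis ℂ W
  rw [← LinearMap.det_toMatrix b, ← LinearMap.det_toMatrix c, map_sub, map_sub,
    LinearMap.toMatrix_one, LinearMap.toMatrix_one, LinearMap.toMatrix_comp b c b,
    LinearMap.toMatrix_comp c b c, Matrix.det_one_sub_mul_comm]

/-- The space is the direct sum of the generalized eigenspaces. On the block of `μ`, `T` is `μ` plus
a nilpotent that commutes with `T ^ j`, so each further factor `T` multiplies the trace by `μ`. -/
theorem trace_pow_eq_sum_roots (T : End ℂ V) (k : ℕ) :
    LinearMap.trace ℂ V (T ^ k) = (T.charpoly.roots.map (· ^ k)).sum := by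
  classical
  have hmaps (j : ℕ) (μ : ℂ) :
      Set.MapsTo (T ^ j) (T.maxGenEigenspace μ) (T.maxGenEigenspace μ) :=
    T.mapsTo_maxGenEigenspace_of_comm ((Commute.refl T).pow_right j) μ
  have hblock (μ : ℂ) (j : ℕ) : LinearMap.trace ℂ _ ((T ^ j).restrict (hmaps j μ)) =
      T.charpoly.rootMultiplicity μ * μ ^ j := by
    induction j with
    | zero =>
      have : (T ^ 0).restrict (hmaps 0 μ) = 1 := by ext; simp
      rw [this, LinearMap.trace_one, LinearMap.finrank_maxGenEigenspace_eq]
      simp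
    | succ j ih =>
      have hT : Set.MapsTo T (T.maxGenEigenspace μ) (T.maxGenEigenspace μ) :=
        T.mapsTo_maxGenEigenspace_of_comm rfl μ
      have e : (T ^ (j + 1)).restrict (hmaps (j + 1) μ) =
          (T ^ j).restrict (hmaps j μ) ∘ₗ T.restrict hT := by
        ext x
        change (T ^ (j + 1)) (x : V) = (T ^ j) (T x)
        rw [pow_succ, Module.End.mul_apply]
      have hc : Commute ((T ^ j).restrict (hmaps j μ)) (T.restrict hT) :=
        LinearMap.restrict_commute ((Commute.refl T).pow_left j) _ _
      rw [e, LinearMap.trace_comp_eq_mul_of_commute_of_isNilpotent μ hc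
        (T.isNilpotent_restrict_maxGenEigenspace_sub_algebraMap μ), ih]
      ring
  have hds := DirectSum.isInternal_submodule_of_iSupIndep_of_iSup_eq_top
    T.independent_maxGenEigenspace T.iSup_maxGenEigenspace_eq_top
  have hfin : {μ | T.maxGenEigenspace μ ≠ ⊥}.Finite :=
    WellFoundedGT.finite_ne_bot_of_iSupIndep T.independent_maxGenEigenspace
  rw [LinearMap.trace_eq_sum_trace_restrict' hds hfin (hmaps k),
    Finset.sum_multiset_map_count]
  simp only [hblock, Polynomial.count_roots, nsmul_eq_mul]
  refine Finset.sum_congr ?_ fun _ _ => rfl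
  ext μ
  rw [Set.Finite.mem_toFinset, Multiset.mem_toFinset, ← Multiset.count_pos, Polynomial.count_roots,
    ← LinearMap.finrank_maxGenEigenspace_eq, Set.mem_ofPred_eq, Submodule.one_le_finrank_iff.symm]
  rfl

theorem det_one_sub_eq_prod_roots (T : End ℂ V) :
    LinearMap.det (1 - T) = (T.charpoly.roots.map (1 - ·)).prod := by
  have h := LinearMap.eval_charpoly T 1
  rw [map_one] at h
  rw [← h]
  conv_lhs => rw [(IsAlgClosed.splits T.charpoly).eq_prod_roots_of_monic T.charpoly_monic]
  rw [Polynomial.eval_multiset_prod, Multiset.map_map]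
  simp

/-- The regularized determinant `det_p (I - T)` of an endomorphism of a finite-dimensional
space. -/
def regDetEnd (p : ℝ) (T : End ℂ V) : ℂ :=
  LinearMap.det (1 - T) *
    Complex.exp (∑ k ∈ Finset.Ico 1 ⌈p⌉₊, LinearMap.trace ℂ V (T ^ k) / (k : ℂ))

/-- The elementary factor `(1 - z) exp (∑_{k=1}^{m-1} z^k / k)`. -/
def elemFactor (m : ℕ) (z : ℂ) : ℂ :=
  (1 - z) * Complex.exp (∑ k ∈ Finset.Ico 1 m, z ^ k / (k : ℂ))

theorem regDetEnd_eq_prod_roots (p : ℝ) (T : End ℂ V) :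
    regDetEnd p T = (T.charpoly.roots.map (elemFactor ⌈p⌉₊)).prod := by
  unfold regDetEnd elemFactor
  simp_rw [trace_pow_eq_sum_roots]
  rw [det_one_sub_eq_prod_roots, Multiset.prod_map_mul]
  congr 1
  generalize T.charpoly.roots = s
  induction s using Multiset.induction_on with
  | empty => simp
  | cons a s ih =>
    rw [Multiset.map_cons, Multiset.prod_cons, ← ih, ← Complex.exp_add, ← Finset.sum_add_distrib]
    simp [add_div]

/-- The function `z ↦ det_p (I - (S + zT))` is entire. -/
theorem differentiable_regDetEnd_add_smul (p : ℝ) (S T : End ℂ V) :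
    Differentiable ℂ fun z : ℂ => regDetEnd p (S + z • T) := by
  classical
  let b := finBasis ℂ V
  unfold regDetEnd
  have hM : ∀ i j, Differentiable ℂ fun z : ℂ => LinearMap.toMatrix b b (S + z • T) i j := by
    intro i j
    simp only [map_add, map_smul, Matrix.add_apply, Matrix.smul_apply, smul_eq_mul]
    fun_prop
  have hpow : ∀ k i j, Differentiable ℂ fun z : ℂ =>
      ((LinearMap.toMatrix b b (S + z • T)) ^ k) i j := by
    intro k
    induction k with
    | zero => intro i j; simp
    | succ k ih =>
      intro i j
      simp only [pow_succ, Matrix.mul_apply]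
      exact Differentiable.fun_sum fun l _ => (ih i l).mul (hM l j)
  refine Differentiable.mul ?_ (Differentiable.cexp (Differentiable.fun_sum fun k _ => ?_))
  · simp_rw [← LinearMap.det_toMatrix b, Matrix.det_apply, map_sub, LinearMap.toMatrix_one]
    refine Differentiable.fun_sum fun σ _ => Differentiable.const_smul ?_ _
    refine Differentiable.fun_finsetProd fun i _ => ?_
    exact (differentiable_const _).sub (hM _ _)
  · simp_rw [LinearMap.trace_eq_matrix_trace ℂ b, ← LinearMap.toMatrix_pow, Matrix.trace]
    exact (Differentiable.fun_sum fun i _ => hpow k i i).div_const _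

end FiniteDimensional

/-! ### Operators of finite rank -/

variable {X : Type*} [NormedAddCommGroup X] [NormedSpace ℂ X]

section

variable {F G : X →L[ℂ] X}

theorem FiniteRank.of_range_le (W : Submodule ℂ X) [FiniteDimensional ℂ W]
    (h : LinearMap.range (F : X →ₗ[ℂ] X) ≤ W) : FiniteRank F :=
  Submodule.finiteDimensional_of_le h

theorem FiniteRank.mul_right (hF : FiniteRank F) (A : X →L[ℂ] X) : FiniteRank (F * A) := by
  have : FiniteDimensional ℂ (LinearMap.range (F : X →ₗ[ℂ] X)) := hF
  refine .of_range_le _ (LinearMap.range_comp_le_range (A : X →ₗ[ℂ] X) (F : X →ₗ[ℂ] X))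

theorem FiniteRank.mul_left (hF : FiniteRank F) (A : X →L[ℂ] X) : FiniteRank (A * F) := by
  have : FiniteDimensional ℂ (LinearMap.range (F : X →ₗ[ℂ] X)) := hF
  refine .of_range_le ((LinearMap.range (F : X →ₗ[ℂ] X)).map (A : X →ₗ[ℂ] X)) ?_
  rintro _ ⟨x, rfl⟩
  exact ⟨F x, ⟨x, rfl⟩, rfl⟩

theorem FiniteRank.add (hF : FiniteRank F) (hG : FiniteRank G) : FiniteRank (F + G) := by
  have : FiniteDimensional ℂ (LinearMap.range (F : X →ₗ[ℂ] X)) := hF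
  have : FiniteDimensional ℂ (LinearMap.range (G : X →ₗ[ℂ] X)) := hG
  exact .of_range_le _ (LinearMap.range_add_le (F : X →ₗ[ℂ] X) (G : X →ₗ[ℂ] X))

theorem FiniteRank.smul (hF : FiniteRank F) (c : ℂ) : FiniteRank (c • F) := by
  simpa using hF.mul_left (c • 1)

theorem FiniteRank.sub (hF : FiniteRank F) (hG : FiniteRank G) : FiniteRank (F - G) := by
  simpa [sub_eq_add_neg] using hF.add (hG.smul (-1))

theorem FiniteRank.pow_succ (hF : FiniteRank F) (k : ℕ) : FiniteRank (F ^ (k + 1)) := by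
  rw [_root_.pow_succ]
  exact hF.mul_left _

end

/-! ### Independence of determinant and trace from the finite-dimensional factorization -/

section Factorization

variable {V : Type*} [AddCommGroup V] [Module ℂ V]
  {F : X →L[ℂ] X} {G : X →ₗ[ℂ] V} {J : V →ₗ[ℂ] X}

/-- If `F = J ∘ G`, then `F_R` and `G ∘ J` are connected by two exchanges of factors. -/
theorem exists_factorization_onRange (h : (F : X →ₗ[ℂ] X) = J ∘ₗ G) :
    ∃ (a : LinearMap.range (F : X →ₗ[ℂ] X) →ₗ[ℂ] LinearMap.range G)
      (b : LinearMap.range G →ₗ[ℂ] LinearMap.range (F : X →ₗ[ℂ] X))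
      (c : LinearMap.range G →ₗ[ℂ] V) (d : V →ₗ[ℂ] LinearMap.range G),
      onRange F = b ∘ₗ a ∧ a ∘ₗ b = d ∘ₗ c ∧ G ∘ₗ J = c ∘ₗ d := by
  have hb : ∀ v : LinearMap.range G, (J ∘ₗ (LinearMap.range G).subtype) v ∈
      LinearMap.range (F : X →ₗ[ℂ] X) := by
    rintro ⟨_, x, rfl⟩
    exact ⟨x, by rw [h]; rfl⟩
  refine ⟨G.rangeRestrict ∘ₗ (LinearMap.range (F : X →ₗ[ℂ] X)).subtype,
    (J ∘ₗ (LinearMap.range G).subtype).codRestrict _ hb,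
    (LinearMap.range G).subtype, G.rangeRestrict ∘ₗ J, ?_, ?_, ?_⟩
  · ext x
    exact LinearMap.congr_fun h (x : X)
  · rfl
  · rfl

variable [FiniteDimensional ℂ V]

theorem FiniteRank.of_factorization (h : (F : X →ₗ[ℂ] X) = J ∘ₗ G) : FiniteRank F :=
  .of_range_le (LinearMap.range J) (h ▸ LinearMap.range_comp_le_range _ _)

theorem detOneSub_eq (h : (F : X →ₗ[ℂ] X) = J ∘ₗ G) :
    detOneSub F = LinearMap.det (1 - G ∘ₗ J) := by
  have : FiniteDimensional ℂ (LinearMap.range (F : X →ₗ[ℂ] X)) :=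
    FiniteRank.of_factorization h
  obtain ⟨a, b, c, d, h₁, h₂, h₃⟩ := exists_factorization_onRange h
  rw [detOneSub, h₁, h₃, det_one_sub_comp_comm, h₂, det_one_sub_comp_comm]

theorem tr_eq (h : (F : X →ₗ[ℂ] X) = J ∘ₗ G) : tr F = LinearMap.trace ℂ V (G ∘ₗ J) := by
  have : FiniteDimensional ℂ (LinearMap.range (F : X →ₗ[ℂ] X)) :=
    FiniteRank.of_factorization h
  obtain ⟨a, b, c, d, h₁, h₂, h₃⟩ := exists_factorization_onRange h
  rw [tr, h₁, h₃, LinearMap.trace_comp_comm', h₂, LinearMap.trace_comp_comm']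

/-- `F ^ (k + 1)` factors as `J (G J)^k` after `G`. The exponent zero is excluded because `F ^ 0 =
I` need not factor through `V`. -/
theorem tr_pow_eq (h : (F : X →ₗ[ℂ] X) = J ∘ₗ G) (k : ℕ) :
    tr (F ^ (k + 1)) = LinearMap.trace ℂ V ((G ∘ₗ J) ^ (k + 1)) := by
  have e : ((F ^ (k + 1) : X →L[ℂ] X) : X →ₗ[ℂ] X) = (J ∘ₗ (G ∘ₗ J) ^ k) ∘ₗ G := by
    induction k with
    | zero => rw [zero_add, pow_one, h]; rfl
    | succ k ih =>
      rw [_root_.pow_succ']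
      change (F : X →ₗ[ℂ] X) ∘ₗ ((F ^ (k + 1) : X →L[ℂ] X) : X →ₗ[ℂ] X) = _
      rw [ih, h, _root_.pow_succ', Module.End.mul_eq_comp]
      rfl
  rw [tr_eq e, _root_.pow_succ', Module.End.mul_eq_comp, LinearMap.comp_assoc]

theorem regDetFin_eq (p : ℝ) (h : (F : X →ₗ[ℂ] X) = J ∘ₗ G) :
    regDetFin p F = regDetEnd p (G ∘ₗ J) := by
  rw [regDetFin, regDetEnd, detOneSub_eq h]
  congr 2
  refine Finset.sum_congr rfl fun k hk => ?_
  obtain ⟨k, rfl⟩ : ∃ j, k = j + 1 := ⟨k - 1, by grind⟩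
  rw [tr_pow_eq h]

end Factorization

/-- The compression of `F` to a subspace `W` that contains its range. -/
def compress (W : Submodule ℂ X) (F : X →L[ℂ] X) (h : ∀ x, F x ∈ W) : End ℂ W :=
  (F : X →ₗ[ℂ] X).codRestrict W h ∘ₗ W.subtype

theorem regDetFin_eq_compress (p : ℝ) (W : Submodule ℂ X) [FiniteDimensional ℂ W]
    (F : X →L[ℂ] X) (h : ∀ x, F x ∈ W) : regDetFin p F = regDetEnd p (compress W F h) :=
  regDetFin_eq p rfl

theorem detOneSub_eq_compress (W : Submodule ℂ X) [FiniteDimensional ℂ W]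
    (F : X →L[ℂ] X) (h : ∀ x, F x ∈ W) : detOneSub F = LinearMap.det (1 - compress W F h) :=
  detOneSub_eq rfl

theorem tr_eq_compress (W : Submodule ℂ X) [FiniteDimensional ℂ W]
    (F : X →L[ℂ] X) (h : ∀ x, F x ∈ W) : tr F = LinearMap.trace ℂ W (compress W F h) :=
  tr_eq rfl

section

variable {F : X →L[ℂ] X}

theorem regDetFin_eq_prod_roots (p : ℝ) (F : X →L[ℂ] X)
    [FiniteDimensional ℂ (LinearMap.range (F : X →ₗ[ℂ] X))] :
    regDetFin p F = ((onRange F).charpoly.roots.map (elemFactor ⌈p⌉₊)).prod := by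
  refine Eq.trans ?_ (regDetEnd_eq_prod_roots p (onRange F))
  exact regDetFin_eq_compress p (LinearMap.range (F : X →ₗ[ℂ] X)) F
    fun x => LinearMap.mem_range_self _ x

/-- Both products factor through the range of `F`, and exchanging the two factors gives the same
endomorphism of that range. -/
theorem FiniteRank.regDetFin_mul_comm (p : ℝ) (hF : FiniteRank F) (B : X →L[ℂ] X) :
    regDetFin p (F * B) = regDetFin p (B * F) := by
  have : FiniteDimensional ℂ (LinearMap.range (F : X →ₗ[ℂ] X)) := hF
  rw [regDetFin_eq p (F := F * B) (G := (F : X →ₗ[ℂ] X).rangeRestrict ∘ₗ (B : X →ₗ[ℂ] X))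
    (J := (LinearMap.range (F : X →ₗ[ℂ] X)).subtype) rfl,
    regDetFin_eq p (F := B * F) (G := (F : X →ₗ[ℂ] X).rangeRestrict)
    (J := (B : X →ₗ[ℂ] X) ∘ₗ (LinearMap.range (F : X →ₗ[ℂ] X)).subtype) rfl]
  rfl

theorem FiniteRank.tr_mul_comm (hF : FiniteRank F) (B : X →L[ℂ] X) :
    tr (F * B) = tr (B * F) := by
  have : FiniteDimensional ℂ (LinearMap.range (F : X →ₗ[ℂ] X)) := hF
  rw [tr_eq (F := F * B) (G := (F : X →ₗ[ℂ] X).rangeRestrict ∘ₗ (B : X →ₗ[ℂ] X))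
    (J := (LinearMap.range (F : X →ₗ[ℂ] X)).subtype) rfl,
    tr_eq (F := B * F) (G := (F : X →ₗ[ℂ] X).rangeRestrict)
    (J := (B : X →ₗ[ℂ] X) ∘ₗ (LinearMap.range (F : X →ₗ[ℂ] X)).subtype) rfl]
  rfl

theorem FiniteRank.exists_compress (hF : FiniteRank F) {G : X →L[ℂ] X} (hG : FiniteRank G) :
    ∃ W : Submodule ℂ X, FiniteDimensional ℂ W ∧ (∀ x, F x ∈ W) ∧ ∀ x, G x ∈ W := by
  have : FiniteDimensional ℂ (LinearMap.range (F : X →ₗ[ℂ] X)) := hF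
  have : FiniteDimensional ℂ (LinearMap.range (G : X →ₗ[ℂ] X)) := hG
  exact ⟨LinearMap.range (F : X →ₗ[ℂ] X) ⊔ LinearMap.range (G : X →ₗ[ℂ] X), inferInstance,
    fun x => Submodule.mem_sup_left ⟨x, rfl⟩, fun x => Submodule.mem_sup_right ⟨x, rfl⟩⟩

theorem FiniteRank.tr_add (hF : FiniteRank F) {G : X →L[ℂ] X} (hG : FiniteRank G) :
    tr (F + G) = tr F + tr G := by
  obtain ⟨W, _, hFW, hGW⟩ := hF.exists_compress hG
  rw [tr_eq_compress W F hFW, tr_eq_compress W G hGW,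
    tr_eq_compress W (F + G) fun x => W.add_mem (hFW x) (hGW x), ← map_add]
  rfl

theorem FiniteRank.tr_sum {ι : Type*} (s : Finset ι) {f : ι → X →L[ℂ] X}
    (hf : ∀ i ∈ s, FiniteRank (f i)) :
    FiniteRank (∑ i ∈ s, f i) ∧ tr (∑ i ∈ s, f i) = ∑ i ∈ s, tr (f i) := by
  classical
  induction s using Finset.induction_on with
  | empty =>
    have h : ((0 : X →L[ℂ] X) : X →ₗ[ℂ] X) = (0 : (⊥ : Submodule ℂ X) →ₗ[ℂ] X) ∘ₗ 0 := by simp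
    exact ⟨.of_factorization h, by simpa using tr_eq h⟩
  | insert i s hi ih =>
    obtain ⟨h₁, h₂⟩ := ih fun j hj => hf j (Finset.mem_insert_of_mem hj)
    have h₃ := hf i (Finset.mem_insert_self i s)
    rw [Finset.sum_insert hi, Finset.sum_insert hi, h₃.tr_add h₁, h₂]
    exact ⟨h₃.add h₁, rfl⟩

theorem FiniteRank.detOneSub_mul (hF : FiniteRank F) {G : X →L[ℂ] X} (hG : FiniteRank G) :
    detOneSub (F + G - F * G) = detOneSub F * detOneSub G := by
  obtain ⟨W, _, hFW, hGW⟩ := hF.exists_compress hG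
  rw [detOneSub_eq_compress W F hFW, detOneSub_eq_compress W G hGW,
    detOneSub_eq_compress W (F + G - F * G) fun x =>
      W.sub_mem (W.add_mem (hFW x) (hGW x)) (hFW _), ← map_mul]
  congr 1
  have : compress W (F + G - F * G) (fun x => W.sub_mem (W.add_mem (hFW x) (hGW x)) (hFW _)) =
      compress W F hFW + compress W G hGW - compress W F hFW * compress W G hGW := rfl
  rw [this]
  generalize compress W F hFW = S
  generalize compress W G hGW = T
  rw [sub_mul, one_mul, mul_sub, mul_one]
  abel

theorem FiniteRank.differentiable_regDetFin (p : ℝ) (hF : FiniteRank F) {G : X →L[ℂ] X}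
    (hG : FiniteRank G) : Differentiable ℂ fun z : ℂ => regDetFin p (F + z • G) := by
  obtain ⟨W, _, hFW, hGW⟩ := hF.exists_compress hG
  convert differentiable_regDetEnd_add_smul p (compress W F hFW) (compress W G hGW) using 2 with z
  exact regDetFin_eq_compress p W (F + z • G) fun x => W.add_mem (hFW x) (W.smul_mem z (hGW x))

/-- For fixed `F` of finite rank, `A ↦ tr (F A)` is a continuous linear functional. -/
theorem FiniteRank.continuous_tr_mul (hF : FiniteRank F) :
    Continuous fun A : X →L[ℂ] X => tr (F * A) := by
  have : FiniteDimensional ℂ (LinearMap.range (F : X →ₗ[ℂ] X)) := hF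
  let R := LinearMap.range (F : X →ₗ[ℂ] X)
  let F' : X →L[ℂ] R := F.codRestrict R fun x => ⟨x, rfl⟩
  let t : (R →L[ℂ] R) →ₗ[ℂ] ℂ := LinearMap.trace ℂ R ∘ₗ ContinuousLinearMap.coeLM ℂ
  have ht : Continuous t := t.continuous_of_finiteDimensional
  have e (A : X →L[ℂ] X) : tr (F * A) = t (F' ∘L A ∘L R.subtypeL) :=
    tr_eq (F := F * A) (G := (F : X →ₗ[ℂ] X).rangeRestrict ∘ₗ (A : X →ₗ[ℂ] X))
      (J := R.subtype) rfl
  simp_rw [e]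
  fun_prop

/-- `I - F` is invertible on `X` if and only if its determinant does not vanish. -/
theorem FiniteRank.isUnit_one_sub_iff (hF : FiniteRank F) :
    IsUnit (1 - F) ↔ detOneSub F ≠ 0 := by
  have : FiniteDimensional ℂ (LinearMap.range (F : X →ₗ[ℂ] X)) := hF
  let R := LinearMap.range (F : X →ₗ[ℂ] X)
  have hdet : detOneSub F ≠ 0 ↔ IsUnit (1 - onRange F) := by
    rw [detOneSub, ← isUnit_iff_ne_zero, LinearMap.isUnit_iff_isUnit_det]
  rw [hdet]
  constructor
  · rintro ⟨u, hu⟩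
    rw [LinearMap.isUnit_iff_ker_eq_bot, LinearMap.ker_eq_bot']
    intro x hx
    have h₁ : (1 - F) (x : X) = 0 := congrArg Subtype.val hx
    have h₂ : (↑u⁻¹ * (1 - F)) (x : X) = 0 := by
      rw [mul_apply_eq_comp, h₁, map_zero]
    rw [← hu, Units.inv_mul] at h₂
    exact Subtype.ext h₂
  · rintro ⟨u, hu⟩
    let F' : X →L[ℂ] R := F.codRestrict R fun x => ⟨x, rfl⟩
    let S : R →L[ℂ] R := LinearMap.toContinuousLinearMap (↑u⁻¹ : End ℂ R)
    have h₁ (x : R) : (S x : X) - F (S x) = x := by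
      have : (1 - onRange F) ((↑u⁻¹ : End ℂ R) x) = x := by
        rw [← Module.End.mul_apply, ← hu, Units.mul_inv]; rfl
      exact congrArg Subtype.val this
    have h₂ (x : R) : S (x - F' x) = x := by
      have : (↑u⁻¹ : End ℂ R) ((1 - onRange F) x) = x := by
        rw [← Module.End.mul_apply, ← hu, Units.inv_mul]; rfl
      exact this
    -- `(I - F)⁻¹ = I + (I - F)⁻¹ F`, and on the range of `F` the inverse is `S`.
    refine ⟨⟨1 - F, 1 + R.subtypeL ∘L S ∘L F', ?_, ?_⟩, rfl⟩
    · ext x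
      have := h₁ (F' x)
      have e : ((F' x : R) : X) = F x := rfl
      rw [e, sub_eq_iff_eq_add] at this
      change (x + ((S (F' x) : R) : X)) - F (x + (S (F' x) : R)) = x
      rw [map_add, ← this, add_sub_cancel_right]
    · ext x
      have := h₂ (F' x)
      have e : F' (x - F x) = F' x - F' (F' x) := by rw [map_sub]; rfl
      rw [← e] at this
      have e' : ((F' x : R) : X) = F x := rfl
      change (x - F x) + ((S (F' (x - F x)) : R) : X) = x
      rw [this, e', sub_add_cancel]

end

end RegDet

end

noncomputable section

namespace RegDet

open Module Metric

/-! ### Riesz projections of finite rank operators -/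

variable {X : Type*} [NormedAddCommGroup X] [NormedSpace ℂ X]

section Resolvent

variable {Z : X →L[ℂ] X} {z : ℂ} {r : ℝ}

theorem IsIsolatingRadius.mem_resolventSet (h : IsIsolatingRadius Z z r) {μ : ℂ}
    (hμ : μ ∈ sphere z r) : μ ∈ resolventSet ℂ Z := by
  by_contra hn
  have : μ = z := h.2 ⟨hn, sphere_subset_closedBall hμ⟩
  rw [this, mem_sphere, dist_self] at hμ
  exact h.1.ne hμ

theorem resolvent_apply_sub {μ : ℂ} (hμ : μ ∈ resolventSet ℂ Z) (x : X) :
    resolvent Z μ (μ • x - Z x) = x := by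
  have : resolvent Z μ * (algebraMap ℂ (X →L[ℂ] X) μ - Z) = 1 := Ring.inverse_mul_cancel _ hμ
  simpa [Algebra.algebraMap_eq_smul_one] using DFunLike.congr_fun this x

theorem sub_resolvent_apply {μ : ℂ} (hμ : μ ∈ resolventSet ℂ Z) (x : X) :
    μ • resolvent Z μ x - Z (resolvent Z μ x) = x := by
  have : (algebraMap ℂ (X →L[ℂ] X) μ - Z) * resolvent Z μ = 1 := Ring.mul_inverse_cancel _ hμ
  simpa [Algebra.algebraMap_eq_smul_one] using DFunLike.congr_fun this x

variable [CompleteSpace X]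

theorem IsIsolatingRadius.continuousOn_resolvent (h : IsIsolatingRadius Z z r) :
    ContinuousOn (resolvent Z) (sphere z r) := fun _ hμ =>
  (spectrum.hasDerivAt_resolvent_const_left
    (h.mem_resolventSet hμ)).continuousAt.continuousWithinAt

theorem IsIsolatingRadius.continuousOn_resolvent_apply (h : IsIsolatingRadius Z z r) (x : X) :
    ContinuousOn (fun μ => resolvent Z μ x) (sphere z r) :=
  h.continuousOn_resolvent.clm_apply continuousOn_const

theorem IsIsolatingRadius.circleIntegral_apply (h : IsIsolatingRadius Z z r) (x : X) :
    (∮ μ in C(z, r), resolvent Z μ) x = ∮ μ in C(z, r), resolvent Z μ x := by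
  have hi : CircleIntegrable (resolvent Z) z r := h.continuousOn_resolvent.circleIntegrable h.1.le
  rw [circleIntegral, ContinuousLinearMap.intervalIntegral_apply hi.out]
  rfl

/-- With `y = (Z - z) x` one has `(μ - z) R(μ) x = x + R(μ) y`, and `y` is killed by one power less.
Each use of this identity raises the order of the pole by one, so the induction must carry all `j`;
only the simple pole contributes to the integral. -/
theorem IsIsolatingRadius.circleIntegral_zpow_smul_resolvent (h : IsIsolatingRadius Z z r) (n : ℕ) :
    ∀ x : X, (((Z : X →ₗ[ℂ] X) - z • 1 : End ℂ X) ^ n) x = 0 → ∀ j : ℕ,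
      ∮ μ in C(z, r), (μ - z) ^ (-(j : ℤ)) • resolvent Z μ x =
        if j = 0 then (2 * Real.pi * Complex.I : ℂ) • x else 0 := by
  induction n with
  | zero =>
    intro x hx j
    have : x = 0 := hx
    simp [this, circleIntegral]
  | succ n ih =>
    intro x hx j
    have hne : ∀ μ ∈ sphere z r, μ - z ≠ 0 := fun μ hμ => by
      rw [sub_ne_zero]; rintro rfl
      rw [mem_sphere, dist_self] at hμ
      exact h.1.ne hμ
    set y := Z x - z • x with hy
    have hyn : (((Z : X →ₗ[ℂ] X) - z • 1 : End ℂ X) ^ n) y = 0 := by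
      rw [pow_succ, Module.End.mul_apply] at hx
      exact hx
    have hz : ∀ i : ℕ, ContinuousOn (fun μ : ℂ => (μ - z) ^ (-(i : ℤ))) (sphere z r) := fun i =>
      ((continuous_id.sub continuous_const).continuousOn).zpow₀ _ fun μ hμ => Or.inl (hne μ hμ)
    have e : Set.EqOn (fun μ => (μ - z) ^ (-(j : ℤ)) • resolvent Z μ x)
        (fun μ => (μ - z) ^ (-((j + 1 : ℕ) : ℤ)) • x +
          (μ - z) ^ (-((j + 1 : ℕ) : ℤ)) • resolvent Z μ y) (sphere z r) := by
      intro μ hμ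
      have hμ' := resolvent_apply_sub (h.mem_resolventSet hμ) x
      have h₁ : (μ - z) • resolvent Z μ x = x + resolvent Z μ y := by
        have e : (μ - z) • x = (μ • x - Z x) + y := by rw [hy]; module
        rw [← map_smul, e, map_add, hμ']
      have h₂ : (μ - z) ^ (-(j : ℤ)) = (μ - z) ^ (-((j + 1 : ℕ) : ℤ)) * (μ - z) := by
        rw [← zpow_add_one₀ (hne μ hμ)]
        congr 1
        push_cast
        ring
      simp only
      rw [h₂, mul_smul, h₁, smul_add]
    rw [circleIntegral.integral_congr h.1.le e, circleIntegral.integral_add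
      (((hz _).fun_smul continuousOn_const).circleIntegrable h.1.le)
      (((hz _).fun_smul (h.continuousOn_resolvent_apply y)).circleIntegrable h.1.le),
      ih y hyn (j + 1), if_neg (Nat.succ_ne_zero j), add_zero, circleIntegral.integral_smul_const]
    rcases Nat.eq_zero_or_pos j with rfl | hj
    · have : ∮ μ in C(z, r), (μ - z) ^ (-((0 + 1 : ℕ) : ℤ)) = 2 * Real.pi * Complex.I := by
        simpa using circleIntegral.integral_sub_center_inv z h.1.ne'
      rw [this, if_pos rfl]
    · rw [circleIntegral.integral_sub_zpow_of_ne (by omega), zero_smul, if_neg hj.ne']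

theorem rieszProjection_apply (h : ∃ r, IsIsolatingRadius Z z r) (x : X) :
    rieszProjection Z z x =
      (2 * Real.pi * Complex.I : ℂ)⁻¹ • ∮ μ in C(z, h.choose), resolvent Z μ x := by
  rw [rieszProjection, dif_pos h, smul_apply, h.choose_spec.circleIntegral_apply]

/-- The Riesz projection is the identity on the generalized eigenspace. -/
theorem rieszProjection_apply_of_mem_maxGenEigenspace (h : ∃ r, IsIsolatingRadius Z z r) {x : X}
    (hx : x ∈ End.maxGenEigenspace (Z : X →ₗ[ℂ] X) z) : rieszProjection Z z x = x := by
  obtain ⟨n, hn⟩ := (Module.End.mem_maxGenEigenspace _ _ _).1 hx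
  have := h.choose_spec.circleIntegral_zpow_smul_resolvent n x hn 0
  simp only [Nat.cast_zero, neg_zero, zpow_zero, one_smul, if_true] at this
  rw [rieszProjection_apply h, this, inv_smul_smul₀ Complex.two_pi_I_ne_zero]

theorem FiniteRank.rieszProjection (hZ : FiniteRank Z) (z : ℂ) (hz : z ≠ 0) :
    FiniteRank (rieszProjection Z z) := by
  by_cases h : ∃ r, IsIsolatingRadius Z z r
  swap
  · rw [RegDet.rieszProjection, dif_neg h]
    simpa using hZ.smul 0
  -- The isolating disc may contain `0` only if `Z` is invertible; being of finite rank, `Z` then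
  -- forces `X` to be finite-dimensional.
  by_cases h0 : (0 : ℂ) ∈ resolventSet ℂ Z
  · have : FiniteRank ((1 : X →L[ℂ] X)) := by
      have := hZ.mul_left (-resolvent Z (0 : ℂ))
      have e := Ring.inverse_mul_cancel _ h0
      change resolvent Z (0 : ℂ) * _ = 1 at e
      rw [map_zero, zero_sub, mul_neg, ← neg_mul] at e
      exact e ▸ this
    simpa using this.mul_left (RegDet.rieszProjection Z z)
  have hs := h.choose_spec
  set r := h.choose with hr
  have h0' : (0 : ℂ) ∉ closedBall z r := fun hmem => hz (hs.2 ⟨h0, hmem⟩).symm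
  have hne : ∀ μ ∈ closedBall z r, μ ≠ 0 := fun μ hμ e => h0' (e ▸ hμ)
  have : FiniteDimensional ℂ (LinearMap.range (Z : X →ₗ[ℂ] X)) := hZ
  -- Integrating `R(μ) x = μ⁻¹ x + Z (μ⁻¹ R(μ) x)` kills the first term by Cauchy's theorem, so the
  -- projection maps into the range of `Z`.
  refine .of_range_le (LinearMap.range (Z : X →ₗ[ℂ] X)) ?_
  rintro _ ⟨x, rfl⟩
  refine ⟨(2 * Real.pi * Complex.I : ℂ)⁻¹ • ∮ μ in C(z, r), μ⁻¹ • resolvent Z μ x, ?_⟩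
  have hc : ContinuousOn (fun μ : ℂ => μ⁻¹) (closedBall z r) := continuousOn_inv₀.mono hne
  have hc' := hc.mono (sphere_subset_closedBall (x := z) (ε := r))
  have hi : CircleIntegrable (fun μ : ℂ => μ⁻¹ • resolvent Z μ x) z r :=
    (hc'.smul (hs.continuousOn_resolvent_apply x)).circleIntegrable hs.1.le
  have e₁ : Z (∮ μ in C(z, r), μ⁻¹ • resolvent Z μ x) =
      ∮ μ in C(z, r), Z (μ⁻¹ • resolvent Z μ x) := by
    rw [circleIntegral, ← ContinuousLinearMap.intervalIntegral_comp_comm Z hi.out]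
    simp [circleIntegral]
  have e₂ : ∮ μ in C(z, r), μ⁻¹ • x = 0 := by
    rw [circleIntegral.integral_smul_const,
      Complex.circleIntegral_eq_zero_of_differentiable_on_off_countable hs.1.le
        Set.countable_empty hc fun μ hμ => differentiableAt_inv (hne μ (ball_subset_closedBall hμ.1)),
      zero_smul]
  have e₃ : Set.EqOn (fun μ => resolvent Z μ x)
      (fun μ => μ⁻¹ • x + Z (μ⁻¹ • resolvent Z μ x)) (sphere z r) := by
    intro μ hμ
    have := sub_resolvent_apply (hs.mem_resolventSet hμ) x
    simp only
    rw [map_smul, ← smul_add]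
    rw [← sub_eq_iff_eq_add.1 this, inv_smul_smul₀ (hne μ (sphere_subset_closedBall hμ))]
  change Z _ = RegDet.rieszProjection Z z x
  rw [map_smul, e₁, rieszProjection_apply h, ← hr, circleIntegral.integral_congr hs.1.le e₃,
    circleIntegral.integral_add ((hc'.fun_smul continuousOn_const).circleIntegrable hs.1.le)
      ((Z.continuous.comp_continuousOn'
        (hc'.fun_smul (hs.continuousOn_resolvent_apply x))).circleIntegrable hs.1.le),
    e₂, zero_add]

end Resolvent

/-! ### Nonzero eigenvalues of finite rank operators and their multiplicities -/

section Eigenvalues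

variable {F : X →L[ℂ] X}

theorem map_maxGenEigenspace_onRange_le (z : ℂ) :
    (End.maxGenEigenspace (onRange F) z).map (LinearMap.range (F : X →ₗ[ℂ] X)).subtype ≤
      End.maxGenEigenspace (F : X →ₗ[ℂ] X) z := by
  rintro _ ⟨x, hx, rfl⟩
  obtain ⟨n, hn⟩ := (Module.End.mem_maxGenEigenspace _ _ _).1 hx
  refine (Module.End.mem_maxGenEigenspace _ _ _).2 ⟨n, ?_⟩
  have key : ∀ k, (((F : X →ₗ[ℂ] X) - z • 1 : End ℂ X) ^ k) (x : X) =
      ((((onRange F) - z • 1) ^ k) x : LinearMap.range (F : X →ₗ[ℂ] X)) := by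
    intro k
    induction k with
    | zero => rfl
    | succ k ih =>
      rw [pow_succ', pow_succ', Module.End.mul_apply, ih]
      rfl
  exact (key n).trans (congrArg Subtype.val hn)

variable [FiniteDimensional ℂ (LinearMap.range (F : X →ₗ[ℂ] X))]

theorem mem_spectrum_iff_isRoot {z : ℂ} (hz : z ≠ 0) :
    z ∈ spectrum ℂ F ↔ (onRange F).charpoly.IsRoot z := by
  have h : FiniteRank F := ‹_›
  have e : algebraMap ℂ (X →L[ℂ] X) z - F = z • (1 - z⁻¹ • F) := by
    rw [smul_sub, smul_inv_smul₀ hz, Algebra.algebraMap_eq_smul_one]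
  have e' : algebraMap ℂ (End ℂ (LinearMap.range (F : X →ₗ[ℂ] X))) z - onRange F =
      z • (1 - z⁻¹ • onRange F) := by
    rw [smul_sub, smul_inv_smul₀ hz, Algebra.algebraMap_eq_smul_one]
  have hd : detOneSub (z⁻¹ • F) = LinearMap.det (1 - z⁻¹ • onRange F) :=
    detOneSub_eq (G := z⁻¹ • (F : X →ₗ[ℂ] X).rangeRestrict)
      (J := (LinearMap.range (F : X →ₗ[ℂ] X)).subtype) rfl
  have hu (A : X →L[ℂ] X) : IsUnit (z • A) ↔ IsUnit A := isUnit_smul_iff (Units.mk0 z hz) A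
  rw [spectrum.mem_iff, e, hu, (h.smul _).isUnit_one_sub_iff, hd, not_not, Polynomial.IsRoot,
    LinearMap.eval_charpoly, e', LinearMap.det_smul]
  simp [hz]

theorem exists_isIsolatingRadius (z : ℂ) : ∃ r, IsIsolatingRadius F z r := by
  have hfin : (spectrum ℂ F \ {z}).Finite := by
    refine ((Set.finite_singleton (0 : ℂ)).union
      (onRange F).charpoly.roots.toFinset.finite_toSet).subset ?_
    rintro μ ⟨hμ, -⟩
    by_cases h0 : μ = 0
    · exact Or.inl h0
    · exact Or.inr (by simpa [LinearMap.charpoly_monic (onRange F) |>.ne_zero] using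
        (mem_spectrum_iff_isRoot h0).1 hμ)
  obtain ⟨r, hr, hball⟩ := Metric.nhds_basis_closedBall.mem_iff.1
    (hfin.isClosed.isOpen_compl.mem_nhds (show z ∈ (spectrum ℂ F \ {z})ᶜ by simp))
  refine ⟨r, hr, fun μ hμ => ?_⟩
  by_contra hn
  exact hball hμ.2 ⟨hμ.1, hn⟩

variable [CompleteSpace X]

/-- The Riesz projection fixes the generalized eigenspace, so its range contains it. This inequality
suffices, since eigenvalue sums are only bounded from above. Finite rank of the projection matters:
`finrank` is `0` in infinite dimension. -/
theorem rootMultiplicity_le_algMult {z : ℂ} (hz : z ≠ 0) :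
    (onRange F).charpoly.rootMultiplicity z ≤ algMult F z := by
  have h : FiniteRank F := ‹_›
  have : FiniteDimensional ℂ (LinearMap.range (rieszProjection F z : X →ₗ[ℂ] X)) :=
    h.rieszProjection z hz
  rw [← LinearMap.finrank_maxGenEigenspace_eq, algMult, 
    (Submodule.equivMapOfInjective (LinearMap.range (F : X →ₗ[ℂ] X)).subtype
      Subtype.val_injective (End.maxGenEigenspace (onRange F) z)).finrank_eq]
  refine Submodule.finrank_mono fun x hx => ⟨x, ?_⟩
  exact rieszProjection_apply_of_mem_maxGenEigenspace (exists_isIsolatingRadius z)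
    (map_maxGenEigenspace_onRange_le z hx)

theorem mem_discreteSpectrum_of_isRoot {z : ℂ} (hz : z ≠ 0)
    (h : (onRange F).charpoly.IsRoot z) : z ∈ discreteSpectrum F := by
  have hF : FiniteRank F := ‹_›
  refine ⟨?_, exists_isIsolatingRadius z, hF.rieszProjection z hz⟩
  obtain ⟨v, hv⟩ := ((Module.End.hasEigenvalue_iff_isRoot_charpoly _ _).2 h).exists_hasEigenvector
  refine Module.End.hasEigenvalue_of_hasEigenvector (x := (v : X))
    ⟨Module.End.mem_eigenspace_iff.2 ?_, fun h0 => hv.2 (Subtype.ext h0)⟩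
  exact congrArg Subtype.val hv.apply_eq_smul

open scoped ENNReal NNReal in
theorem sum_roots_rpow_le {p : ℝ} (hp : 0 < p) {C : ℝ} (hC : 0 ≤ C)
    (h : eigenvalueLpNorm p F ≤ ENNReal.ofReal C) :
    ((onRange F).charpoly.roots.map (‖·‖ ^ p)).sum ≤ C ^ p := by
  classical
  have h₁ : ∑' z : discreteSpectrum F, (algMult F z : ℝ≥0∞) * ENNReal.ofReal (‖(z : ℂ)‖ ^ p) ≤
      ENNReal.ofReal (C ^ p) := by
    rwa [eigenvalueLpNorm, one_div, ENNReal.rpow_inv_le_iff hp,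
      ENNReal.ofReal_rpow_of_nonneg hC hp.le] at h
  -- Zero roots need not be discrete eigenvalues, but they add nothing to the sum, because `0 ^ p =
  -- 0` for `p > 0`.
  let s : Finset ℂ := (onRange F).charpoly.roots.toFinset.filter (· ≠ 0)
  have hs : ∀ z ∈ s, z ∈ discreteSpectrum F := fun z hz => by
    obtain ⟨hz, h0⟩ := Finset.mem_filter.1 hz
    exact mem_discreteSpectrum_of_isRoot h0
      (Polynomial.isRoot_of_mem_roots (Multiset.mem_toFinset.1 hz))
  have h₂ : ((onRange F).charpoly.roots.map (‖·‖ ^ p)).sum =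
      ∑ z ∈ s, ((onRange F).charpoly.rootMultiplicity z : ℝ) * ‖z‖ ^ p := by
    rw [Finset.sum_multiset_map_count, Finset.sum_filter]
    refine Finset.sum_congr rfl fun z _ => ?_
    rw [Polynomial.count_roots, nsmul_eq_mul]
    split_ifs with h0
    · rfl
    · rw [not_not.1 h0, norm_zero, Real.zero_rpow hp.ne', mul_zero]
  rw [h₂, ← ENNReal.ofReal_le_ofReal_iff (by positivity),
    ENNReal.ofReal_sum_of_nonneg fun _ _ => by positivity]
  refine le_trans ?_ h₁
  calc ∑ z ∈ s, ENNReal.ofReal (((onRange F).charpoly.rootMultiplicity z : ℝ) * ‖z‖ ^ p)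
      ≤ ∑ z ∈ s, (algMult F z : ℝ≥0∞) * ENNReal.ofReal (‖z‖ ^ p) := by
        refine Finset.sum_le_sum fun z hz => ?_
        rw [ENNReal.ofReal_mul (by positivity), ENNReal.ofReal_natCast]
        gcongr
        exact rootMultiplicity_le_algMult (Finset.mem_filter.1 hz).2
    _ = ∑ z ∈ s.attach.map ⟨fun z : s => (⟨z, hs z z.2⟩ : discreteSpectrum F),
          fun a b hab => Subtype.ext (congrArg (fun w : discreteSpectrum F => (w : ℂ)) hab)⟩,
          (algMult F z : ℝ≥0∞) * ENNReal.ofReal (‖(z : ℂ)‖ ^ p) := by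
        rw [Finset.sum_map, ← Finset.sum_attach]
        rfl
    _ ≤ _ := ENNReal.sum_le_tsum _

end Eigenvalues

end RegDet

end

noncomputable section

namespace RegDet

open Module

/-! ### Bounds for elementary factors and regularized determinants -/

theorem elemFactor_eq_exp (n : ℕ) {z : ℂ} (hz : ‖z‖ < 1) :
    elemFactor (n + 1) z =
      Complex.exp (Complex.log (1 + -z) - Complex.logTaylor (n + 1) (-z)) := by
  have h1 : (1 : ℂ) + -z ≠ 0 := fun h => by
    have : z = 1 := by linear_combination -h
    simp [this] at hz
  rw [sub_eq_add_neg, Complex.exp_add, Complex.exp_log h1, elemFactor, sub_eq_add_neg]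
  congr 2
  -- The Taylor sum starts at `k = 0`, where division by zero makes the term vanish.
  rw [Complex.logTaylor, Finset.range_eq_Ico, Finset.sum_eq_sum_Ico_succ_bot (Nat.succ_pos n),
    Nat.cast_zero, div_zero, zero_add, ← Finset.sum_neg_distrib]
  refine Finset.sum_congr rfl fun k _ => ?_
  rw [neg_pow z, ← mul_assoc, ← pow_add, Odd.neg_one_pow ⟨k, by ring⟩]
  ring

theorem norm_log_sub_logTaylor_le_rpow {p : ℝ} {n : ℕ} (hn : p ≤ (n + 1 : ℕ)) (hp : 0 < p) {z : ℂ}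
    (hz : ‖z‖ ≤ 1 / 2) :
    ‖Complex.log (1 + -z) - Complex.logTaylor (n + 1) (-z)‖ ≤ 2 * ‖z‖ ^ p := by
  have hz1 : ‖-z‖ < 1 := by rw [norm_neg]; linarith
  refine (Complex.norm_log_sub_logTaylor_le n hz1).trans ?_
  rw [norm_neg] at hz1 ⊢
  have h₁ : (1 - ‖z‖)⁻¹ ≤ 2 := by
    rw [inv_le_comm₀ (by linarith) two_pos]; linarith
  have h₂ : ‖z‖ ^ (n + 1) ≤ ‖z‖ ^ p := by
    rw [← Real.rpow_natCast]
    exact Real.rpow_le_rpow_of_exponent_ge' (norm_nonneg z) hz1.le hp.le hn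
  have h₃ : (0 : ℝ) < 1 - ‖z‖ := by linarith
  calc ‖z‖ ^ (n + 1) * (1 - ‖z‖)⁻¹ / (n + 1) ≤ ‖z‖ ^ (n + 1) * (1 - ‖z‖)⁻¹ :=
        div_le_self (by positivity) (by linarith [n.cast_nonneg (α := ℝ)])
    _ ≤ ‖z‖ ^ p * 2 := by gcongr
    _ = 2 * ‖z‖ ^ p := mul_comm _ _

/-- `p ≤ n + 1` controls the logarithmic tail for small `z`, and `n < p` controls the polynomial in
the exponent for large `z`. -/
theorem ceil_eq_add_one {p : ℝ} (hp : 0 < p) :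
    ∃ n : ℕ, ⌈p⌉₊ = n + 1 ∧ p ≤ (n + 1 : ℕ) ∧ (n : ℝ) < p := by
  obtain ⟨n, hn⟩ := Nat.exists_eq_succ_of_ne_zero (Nat.ceil_pos.2 hp).ne'
  exact ⟨n, hn, Nat.ceil_le.1 hn.le, Nat.lt_ceil.1 (hn ▸ Nat.lt_succ_self n)⟩

theorem exp_neg_le_norm_elemFactor {p : ℝ} (hp : 0 < p) {z : ℂ} (hz : ‖z‖ ≤ 1 / 2) :
    Real.exp (-(2 * ‖z‖ ^ p)) ≤ ‖elemFactor ⌈p⌉₊ z‖ := by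
  obtain ⟨n, hn, hpn, -⟩ := ceil_eq_add_one hp
  rw [hn, elemFactor_eq_exp n (by linarith), Complex.norm_exp, Real.exp_le_exp]
  exact (neg_le_neg (norm_log_sub_logTaylor_le_rpow hpn hp hz)).trans
    (neg_le_of_abs_le (Complex.abs_re_le_norm _))

theorem exists_norm_elemFactor_le {p : ℝ} (hp : 0 < p) :
    ∃ C : ℝ, 0 ≤ C ∧ ∀ z : ℂ, ‖elemFactor ⌈p⌉₊ z‖ ≤ Real.exp (C * ‖z‖ ^ p) := by
  obtain ⟨n, hn, hpn, hnp⟩ := ceil_eq_add_one hp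
  -- For `t = 2|z| ≥ 1`, the factor `1 - z` costs `(1 + 1/p) t^p` and the exponential costs `n t^p`,
  -- where `t^p = 2^p |z|^p`. The summand `2` serves `|z| ≤ 1/2`.
  refine ⟨(1 + 1 / p + n) * 2 ^ p + 2, by positivity, fun z => ?_⟩
  rw [hn]
  have hz0 : 0 ≤ ‖z‖ ^ p := by positivity
  rcases le_total ‖z‖ (1 / 2) with hz | hz
  · rw [elemFactor_eq_exp n (by linarith), Complex.norm_exp, Real.exp_le_exp]
    refine (Complex.re_le_norm _).trans ((norm_log_sub_logTaylor_le_rpow hpn hp hz).trans ?_)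
    gcongr
    linarith [show 0 ≤ (1 + 1 / p + n) * 2 ^ p by positivity]
  · set t := 2 * ‖z‖ with ht
    have ht1 : 1 ≤ t := by linarith
    have ht0 : 0 < t := by linarith
    have htp : t ^ p = 2 ^ p * ‖z‖ ^ p := Real.mul_rpow two_pos.le (norm_nonneg z)
    have h1t : 1 ≤ t ^ p := Real.one_le_rpow ht1 hp.le
    have h₁ : ‖1 - z‖ ≤ Real.exp (t ^ p + t ^ p / p) := by
      calc ‖1 - z‖ ≤ 1 + ‖z‖ := by simpa using norm_sub_le (1 : ℂ) z
        _ ≤ (1 + 1) * t := by linarith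
        _ ≤ Real.exp (t ^ p) * Real.exp (Real.log t) := by
          rw [Real.exp_log ht0]
          gcongr
          linarith [Real.add_one_le_exp (t ^ p)]
        _ ≤ Real.exp (t ^ p) * Real.exp (t ^ p / p) := by
          gcongr
          exact Real.log_le_rpow_div ht0.le hp
        _ = _ := (Real.exp_add _ _).symm
    have h₂ : ‖∑ k ∈ Finset.Ico 1 (n + 1), z ^ k / (k : ℂ)‖ ≤ n * t ^ p := by
      calc ‖∑ k ∈ Finset.Ico 1 (n + 1), z ^ k / (k : ℂ)‖
          ≤ ∑ k ∈ Finset.Ico 1 (n + 1), t ^ p := by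
            refine norm_sum_le_of_le _ fun k hk => ?_
            obtain ⟨hk1, hkn⟩ := Finset.mem_Ico.1 hk
            have hk' : (1 : ℝ) ≤ k := by exact_mod_cast hk1
            have hk'' : (k : ℝ) ≤ p := by
              have : (k : ℝ) ≤ n := by exact_mod_cast Nat.lt_succ_iff.1 hkn
              linarith
            rw [norm_div, norm_pow, Complex.norm_natCast]
            calc ‖z‖ ^ k / k ≤ ‖z‖ ^ k := div_le_self (by positivity) hk'
              _ ≤ t ^ k := by gcongr; linarith [norm_nonneg z]
              _ = t ^ (k : ℝ) := (Real.rpow_natCast _ _).symm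
              _ ≤ t ^ p := Real.rpow_le_rpow_of_exponent_le ht1 hk''
        _ = n * t ^ p := by simp
    rw [elemFactor, norm_mul]
    calc ‖1 - z‖ * ‖Complex.exp (∑ k ∈ Finset.Ico 1 (n + 1), z ^ k / (k : ℂ))‖
        ≤ Real.exp (t ^ p + t ^ p / p) * Real.exp (n * t ^ p) := by
          gcongr
          rw [Complex.norm_exp]
          exact Real.exp_le_exp.2 ((Complex.re_le_norm _).trans h₂)
      _ = Real.exp ((1 + 1 / p + n) * 2 ^ p * ‖z‖ ^ p) := by
          rw [← Real.exp_add, mul_assoc, ← htp]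
          congr 1
          ring
      _ ≤ _ := by
          gcongr
          linarith

theorem norm_multiset_prod_le_exp {s : Multiset ℂ} {f : ℂ → ℂ} {g : ℂ → ℝ}
    (h : ∀ z ∈ s, ‖f z‖ ≤ Real.exp (g z)) : ‖(s.map f).prod‖ ≤ Real.exp (s.map g).sum := by
  induction s using Multiset.induction_on with
  | empty => simp
  | cons a s ih =>
    rw [Multiset.map_cons, Multiset.map_cons, Multiset.prod_cons, Multiset.sum_cons, norm_mul,
      Real.exp_add]
    gcongr
    · exact h a (Multiset.mem_cons_self a s)
    · exact ih fun z hz => h z (Multiset.mem_cons_of_mem hz)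

theorem exp_le_norm_multiset_prod {s : Multiset ℂ} {f : ℂ → ℂ} {g : ℂ → ℝ}
    (h : ∀ z ∈ s, Real.exp (g z) ≤ ‖f z‖) : Real.exp (s.map g).sum ≤ ‖(s.map f).prod‖ := by
  induction s using Multiset.induction_on with
  | empty => simp
  | cons a s ih =>
    rw [Multiset.map_cons, Multiset.map_cons, Multiset.prod_cons, Multiset.sum_cons, norm_mul,
      Real.exp_add]
    gcongr
    · exact h a (Multiset.mem_cons_self a s)
    · exact ih fun z hz => h z (Multiset.mem_cons_of_mem hz)

variable {X : Type*} [NormedAddCommGroup X] [NormedSpace ℂ X] {F : X →L[ℂ] X} {p : ℝ}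

theorem norm_le_opNorm_of_mem_roots [FiniteDimensional ℂ (LinearMap.range (F : X →ₗ[ℂ] X))] {z : ℂ}
    (hz : z ∈ (onRange F).charpoly.roots) : ‖z‖ ≤ ‖F‖ := by
  obtain ⟨v, hv⟩ := ((Module.End.hasEigenvalue_iff_isRoot_charpoly _ _).2
    (Polynomial.isRoot_of_mem_roots hz)).exists_hasEigenvector
  have h : F v = z • (v : X) := congrArg Subtype.val hv.apply_eq_smul
  have hv0 : 0 < ‖(v : X)‖ := norm_pos_iff.2 fun h0 => hv.2 (Subtype.ext h0)
  have := F.le_opNorm v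
  rw [h, norm_smul] at this
  exact le_of_mul_le_mul_right this hv0

variable [CompleteSpace X]

theorem exists_norm_regDetFin_le (hp : 0 < p) :
    ∃ C : ℝ, 0 ≤ C ∧ ∀ F : X →L[ℂ] X, FiniteRank F → ∀ M : ℝ, 0 ≤ M →
      eigenvalueLpNorm p F ≤ ENNReal.ofReal M → ‖regDetFin p F‖ ≤ Real.exp (C * M ^ p) := by
  obtain ⟨C, hC, h⟩ := exists_norm_elemFactor_le hp
  refine ⟨C, hC, fun F hF M hM hFM => ?_⟩
  have : FiniteDimensional ℂ (LinearMap.range (F : X →ₗ[ℂ] X)) := hF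
  rw [regDetFin_eq_prod_roots]
  refine (norm_multiset_prod_le_exp fun z _ => h z).trans ?_
  rw [Multiset.sum_map_mul_left]
  gcongr
  exact sum_roots_rpow_le hp hM hFM

/-- All eigenvalues lie in the disc where the elementary factor is bounded below. The bound depends
on `F` only through `M`, so it survives limits. -/
theorem FiniteRank.exp_neg_le_norm_regDetFin (hp : 0 < p) (hF : FiniteRank F)
    (hF2 : ‖F‖ ≤ 1 / 2) {M : ℝ} (hM : 0 ≤ M) (hFM : eigenvalueLpNorm p F ≤ ENNReal.ofReal M) :
    Real.exp (-(2 * M ^ p)) ≤ ‖regDetFin p F‖ := by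
  have : FiniteDimensional ℂ (LinearMap.range (F : X →ₗ[ℂ] X)) := hF
  rw [regDetFin_eq_prod_roots]
  refine le_trans ?_ (exp_le_norm_multiset_prod fun z hz => exp_neg_le_norm_elemFactor hp
    ((norm_le_opNorm_of_mem_roots hz).trans hF2))
  simp_rw [← neg_mul]
  rw [Multiset.sum_map_mul_left, Real.exp_le_exp, neg_mul, neg_mul, neg_le_neg_iff]
  gcongr
  exact sum_roots_rpow_le hp hM hFM

end RegDet

end

noncomputable section

namespace RegDet

open Filter Topology

/-! ### Quasi-norms and extension by continuity -/

section QuasiNorm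

variable {V : Type*} [AddCommGroup V] {N : V → ℝ} {D E : V → ℂ}

theorem QuasiContinuous.eq_of_dense {S : Set V} (hS : ∀ x, ∀ ε > 0, ∃ y ∈ S, N (y - x) < ε)
    (hD : QuasiContinuous N D) (hE : QuasiContinuous N E) (h : ∀ x ∈ S, D x = E x) : D = E := by
  funext x
  refine eq_of_forall_dist_le fun ε hε => ?_
  obtain ⟨δ₁, hδ₁, H₁⟩ := hD x (ε / 2) (half_pos hε)
  obtain ⟨δ₂, hδ₂, H₂⟩ := hE x (ε / 2) (half_pos hε)
  obtain ⟨y, hyS, hy⟩ := hS x (min δ₁ δ₂) (lt_min hδ₁ hδ₂)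
  have h₁ := H₁ y (hy.trans_le (min_le_left _ _))
  have h₂ := H₂ y (hy.trans_le (min_le_right _ _))
  rw [← dist_eq_norm] at h₁ h₂
  rw [h y hyS, dist_comm] at h₁
  linarith [dist_triangle (D x) (E y) (E x)]

variable [Module ℂ V]

theorem IsQuasiNorm.map_zero (h : IsQuasiNorm N) : N 0 = 0 := (h.eq_zero_iff 0).2 rfl

theorem IsQuasiNorm.map_sub_rev (h : IsQuasiNorm N) (x y : V) : N (x - y) = N (y - x) := by
  rw [← neg_sub, ← neg_one_smul ℂ, h.smul]
  simp

theorem quasiContinuous_iff_tendsto (h : IsQuasiNorm N) :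
    QuasiContinuous N D ↔ ∀ x, Tendsto D (comap (fun y => N (y - x)) (𝓝 0)) (𝓝 (D x)) := by
  refine forall_congr' fun x => ?_
  rw [(Metric.nhds_basis_ball.comap _).tendsto_iff Metric.nhds_basis_ball]
  refine forall₂_congr fun ε hε => exists_congr fun δ => and_congr_right fun hδ => ?_
  refine forall_congr' fun y => ?_
  simp [dist_eq_norm, abs_of_nonneg (h.nonneg _)]

theorem QuasiContinuous.mul (h : IsQuasiNorm N) (hD : QuasiContinuous N D)
    (hE : QuasiContinuous N E) : QuasiContinuous N fun x => D x * E x := by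
  rw [quasiContinuous_iff_tendsto h] at *
  exact fun x => (hD x).mul (hE x)

theorem QuasiContinuous.comp (hD : QuasiContinuous N D) {φ : V → V} {K : ℝ}
    (hφ : ∀ x y, N (φ x - φ y) ≤ K * N (x - y)) (h : IsQuasiNorm N) :
    QuasiContinuous N fun x => D (φ x) := by
  intro x ε hε
  obtain ⟨δ, hδ, H⟩ := hD (φ x) ε hε
  refine ⟨δ / (|K| + 1), by positivity, fun y hy => H _ ?_⟩
  calc N (φ y - φ x) ≤ K * N (y - x) := hφ y x
    _ ≤ (|K| + 1) * N (y - x) :=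
      mul_le_mul_of_nonneg_right (by linarith [le_abs_self K]) (h.nonneg _)
    _ < δ := by rwa [lt_div_iff₀' (by positivity)] at hy

/-- A function on a dense set that is Lipschitz on bounded sets extends continuously. -/
theorem IsQuasiNorm.exists_extension (h : IsQuasiNorm N) {S : Set V}
    (hS : ∀ x, ∀ ε > 0, ∃ y ∈ S, N (y - x) < ε) {d : V → ℂ}
    (hd : ∀ M : ℝ, ∃ K : ℝ, ∀ x ∈ S, ∀ y ∈ S, N x ≤ M → N y ≤ M →
      ‖d x - d y‖ ≤ K * N (x - y)) :
    ∃ D : V → ℂ, QuasiContinuous N D ∧ ∀ x ∈ S, D x = d x := by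
  obtain ⟨q, hq, htri⟩ := h.quasi_triangle
  have hq0 : 0 < q := by linarith
  -- a common local Lipschitz constant
  have hloc : ∀ x, ∃ K : ℝ, 0 < K ∧ ∀ y ∈ S, ∀ z ∈ S, N (y - x) ≤ 1 → N (z - x) ≤ 1 →
      ‖d y - d z‖ ≤ K * (N (y - x) + N (z - x)) := by
    intro x
    obtain ⟨K, hK⟩ := hd (q * (1 + N x))
    refine ⟨(|K| + 1) * q, by positivity, fun y hy z hz hy1 hz1 => ?_⟩
    have hb : ∀ w, N (w - x) ≤ 1 → N w ≤ q * (1 + N x) := fun w hw => by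
      have := htri (w - x) x
      rw [sub_add_cancel] at this
      exact this.trans (by gcongr)
    have h₁ : N (y - z) ≤ q * (N (y - x) + N (z - x)) := by
      have := htri (y - x) (x - z)
      rwa [sub_add_sub_cancel, h.map_sub_rev x z] at this
    calc ‖d y - d z‖ ≤ K * N (y - z) := hK y hy z hz (hb y hy1) (hb z hz1)
      _ ≤ (|K| + 1) * N (y - z) :=
        mul_le_mul_of_nonneg_right (by linarith [le_abs_self K]) (h.nonneg _)
      _ ≤ (|K| + 1) * (q * (N (y - x) + N (z - x))) := by gcongr
      _ = _ := by ring
  have hlim : ∀ x, ∃ c : ℂ, ∀ ε > 0, ∃ δ > 0, ∀ y ∈ S, N (y - x) < δ → ‖d y - c‖ < ε := by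
    intro x
    obtain ⟨K, hK0, hK⟩ := hloc x
    have hpos : ∀ n : ℕ, (0 : ℝ) < 1 / (n + 1) := fun n => Nat.one_div_pos_of_nat
    -- `V` need not be complete: only the values `d (a n)` have to converge, in `ℂ`.
    choose a haS ha using fun n : ℕ => hS x (1 / (n + 1)) (hpos n)
    have hle1 : ∀ n : ℕ, (1 : ℝ) / (n + 1) ≤ 1 := fun n => by
      rw [div_le_one (by positivity)]
      linarith [n.cast_nonneg (α := ℝ)]
    have ha0 : Tendsto (fun n => N (a n - x)) atTop (𝓝 0) :=
      squeeze_zero (fun n => h.nonneg _) (fun n => (ha n).le) tendsto_one_div_add_atTop_nhds_zero_nat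
    have hcau : CauchySeq fun n => d (a n) := by
      rw [Metric.cauchySeq_iff']
      intro ε hε
      obtain ⟨n₀, hn₀⟩ := (ha0.eventually_lt_const (show 0 < ε / (K * 2) by positivity)).exists_forall_of_atTop
      refine ⟨n₀, fun n hn => ?_⟩
      rw [dist_eq_norm]
      refine (hK _ (haS n) _ (haS n₀) ((ha n).le.trans (hle1 n))
        ((ha n₀).le.trans (hle1 n₀))).trans_lt ?_
      have h₁ := hn₀ n hn
      have h₂ := hn₀ n₀ le_rfl
      calc K * (N (a n - x) + N (a n₀ - x)) < K * (ε / (K * 2) + ε / (K * 2)) := by gcongr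
        _ = ε := by field_simp; ring
    obtain ⟨c, hc⟩ := cauchySeq_tendsto_of_complete hcau
    refine ⟨c, fun ε hε => ⟨min 1 (ε / (2 * K)), by positivity, fun y hy hyx => ?_⟩⟩
    have hy1 : N (y - x) ≤ 1 := (hyx.trans_le (min_le_left _ _)).le
    -- A quasi-norm need not be continuous, so the limit is taken in a bound that involves `a n`
    -- only through `N (a n - x)`.
    have hlimit : ‖d y - c‖ ≤ K * (N (y - x) + 0) :=
      le_of_tendsto_of_tendsto' (tendsto_const_nhds.sub hc).norm
        ((tendsto_const_nhds.add ha0).const_mul K) fun n =>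
          hK y hy _ (haS n) hy1 ((ha n).le.trans (hle1 n))
    have h₂ := hyx.trans_le (min_le_right _ _)
    rw [lt_div_iff₀ (by positivity)] at h₂
    nlinarith [h.nonneg (y - x)]
  choose D hD using hlim
  refine ⟨D, fun x ε hε => ?_, fun x hx => ?_⟩
  · obtain ⟨δ, hδ, H⟩ := hD x (ε / 2) (half_pos hε)
    refine ⟨δ / (2 * q), by positivity, fun y hy => ?_⟩
    obtain ⟨δ', hδ', H'⟩ := hD y (ε / 2) (half_pos hε)
    obtain ⟨z, hzS, hz⟩ := hS y (min δ' (δ / (2 * q))) (by positivity)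
    have h₁ := H' z hzS (hz.trans_le (min_le_left _ _))
    have h₂ : N (z - x) < δ := by
      have := htri (z - y) (y - x)
      rw [sub_add_sub_cancel] at this
      have h₃ := hz.trans_le (min_le_right _ _)
      calc N (z - x) ≤ q * (N (z - y) + N (y - x)) := this
        _ < q * (δ / (2 * q) + δ / (2 * q)) := by gcongr
        _ = δ := by field_simp; ring
    have h₃ := H z hzS h₂
    rw [← dist_eq_norm] at *
    rw [dist_comm] at h₁
    linarith [dist_triangle (D y) (d z) (D x)]
  · refine eq_of_forall_dist_le fun ε hε => ?_
    obtain ⟨δ, hδ, H⟩ := hD x ε hε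
    have := H x hx (by rwa [sub_self, h.map_zero])
    rw [dist_comm, dist_eq_norm]
    exact this.le

end QuasiNorm

/-! ### The regularized determinant on an `l_p`-ideal -/

variable {X : Type*} [NormedAddCommGroup X] [NormedSpace ℂ X]
  {p : ℝ} {𝓘 : Submodule ℂ (X →L[ℂ] X)} {N : 𝓘 → ℝ}

theorem IsLpIdeal.exists_eigenvalueLpNorm_le (h : IsLpIdeal p 𝓘 N) :
    ∃ γ : ℝ, 0 ≤ γ ∧ ∀ (L : 𝓘) (M : ℝ), N L ≤ M →
      eigenvalueLpNorm p (L : X →L[ℂ] X) ≤ ENNReal.ofReal (γ * M) := by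
  obtain ⟨γ, hγ⟩ := h.eigenvalue_le
  refine ⟨γ, γ.coe_nonneg, fun L M hM => (hγ L).trans ?_⟩
  rw [ENNReal.ofReal_mul γ.coe_nonneg, ENNReal.ofReal_coe_nnreal]
  gcongr

/-- `F ↦ det_p (I - F)` is Lipschitz on bounded sets of finite rank operators. -/
theorem IsLpIdeal.exists_lipschitz [CompleteSpace X] (hp : 0 < p) (h : IsLpIdeal p 𝓘 N) (M : ℝ) :
    ∃ K : ℝ, ∀ A : 𝓘, FiniteRank (A : X →L[ℂ] X) → ∀ B : 𝓘, FiniteRank (B : X →L[ℂ] X) →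
      N A ≤ M → N B ≤ M →
      ‖regDetFin p (A : X →L[ℂ] X) - regDetFin p (B : X →L[ℂ] X)‖ ≤ K * N (A - B) := by
  obtain ⟨q, hq, htri⟩ := h.quasiNorm.quasi_triangle
  obtain ⟨γ, hγ, hle⟩ := h.exists_eigenvalueLpNorm_le
  obtain ⟨C, hC, hbound⟩ := exists_norm_regDetFin_le (X := X) hp
  -- This bounds `N (B + z (A - B))` for `|z| < 1 + ρ⁻¹`, where `ρ = N (A - B) ≤ q (M + M)` and
  -- hence `|z| ρ ≤ ρ + 1`.
  set M' := q * (M + (q * (M + M) + 1)) with hM'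
  refine ⟨2 * Real.exp (C * (γ * M') ^ p), fun A hA B hB hAM hBM => ?_⟩
  rcases (h.quasiNorm.nonneg (A - B)).eq_or_lt with h0 | hρ
  · rw [sub_eq_zero.1 ((h.quasiNorm.eq_zero_iff _).1 h0.symm)]
    simp [h.quasiNorm.map_zero]
  set ρ := N (A - B) with hρ_def
  have hM0 : 0 ≤ M := (h.quasiNorm.nonneg A).trans hAM
  have hM'0 : 0 ≤ M' := by positivity
  have hρM : ρ ≤ q * (M + M) := by
    have := htri A (-B)
    rw [← sub_eq_add_neg, ← zero_sub B, h.quasiNorm.map_sub_rev 0 B, sub_zero] at this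
    exact this.trans (by gcongr)
  let f : ℂ → ℂ := fun z => regDetFin p ((B : X →L[ℂ] X) + z • ((A : X →L[ℂ] X) - (B : X →L[ℂ] X)))
  have hfd : Differentiable ℂ f := hB.differentiable_regDetFin p (hA.sub hB)
  have hfb : ∀ z : ℂ, ‖z‖ < 1 + ρ⁻¹ → ‖f z‖ ≤ Real.exp (C * (γ * M') ^ p) := by
    intro z hz
    refine hbound _ (hB.add ((hA.sub hB).smul z)) _ (by positivity) (hle (B + z • (A - B)) _ ?_)
    refine (htri _ _).trans ?_
    rw [h.quasiNorm.smul]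
    have hzρ : ‖z‖ * ρ ≤ ρ + 1 := by
      calc ‖z‖ * ρ ≤ (1 + ρ⁻¹) * ρ := by gcongr
        _ = ρ + 1 := by field_simp
    exact mul_le_mul_of_nonneg_left (add_le_add hBM (by linarith)) (by linarith)
  have hmaps : Set.MapsTo f (Metric.ball 0 (1 + ρ⁻¹))
      (Metric.closedBall (f 0) (2 * Real.exp (C * (γ * M') ^ p))) := by
    intro z hz
    rw [Metric.mem_closedBall, dist_eq_norm]
    have h₁ := hfb z (by simpa using hz)
    have h₂ := hfb 0 (by rw [norm_zero]; positivity)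
    linarith [norm_sub_le (f z) (f 0)]
  have h1 : (1 : ℂ) ∈ Metric.ball (0 : ℂ) (1 + ρ⁻¹) := by simpa using hρ
  -- Schwarz lemma: the disc contains `1`, and its inverse radius `(1 + ρ⁻¹)⁻¹` is at most `ρ`,
  -- which yields the Lipschitz factor.
  have key := Complex.dist_le_div_mul_dist_of_mapsTo_ball hfd.differentiableOn hmaps h1
  have e1 : f 1 = regDetFin p (A : X →L[ℂ] X) := by simp [f]
  have e0 : f 0 = regDetFin p (B : X →L[ℂ] X) := by simp [f]
  rw [e1, e0, dist_eq_norm, dist_zero_right, norm_one, mul_one] at key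
  refine key.trans ?_
  rw [div_eq_mul_inv]
  gcongr
  rw [inv_le_comm₀ (by positivity) hρ]
  linarith

theorem IsLpIdeal.dense' (h : IsLpIdeal p 𝓘 N) :
    ∀ L : 𝓘, ∀ ε > 0, ∃ F ∈ {F : 𝓘 | FiniteRank (F : X →L[ℂ] X)}, N (F - L) < ε :=
  h.dense

theorem IsLpIdeal.existsUnique_isRegDet [CompleteSpace X] (hp : 0 < p) (h : IsLpIdeal p 𝓘 N) :
    ∃! D : 𝓘 → ℂ, IsRegDet p 𝓘 N D := by
  obtain ⟨D, hD, hDF⟩ := h.quasiNorm.exists_extension h.dense'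
    (d := fun F => regDetFin p (F : X →L[ℂ] X)) (h.exists_lipschitz hp)
  exact ⟨D, ⟨hD, hDF⟩, fun E hE => hE.continuous.eq_of_dense h.dense' hD fun F hF =>
    (hE.extends_fin F hF).trans (hDF F hF).symm⟩

theorem IsLpIdeal.isRegDet_regDet [CompleteSpace X] (hp : 0 < p) (h : IsLpIdeal p 𝓘 N) :
    IsRegDet p 𝓘 N (regDet p 𝓘 N) := by
  have hex := (h.existsUnique_isRegDet hp).exists
  rw [regDet, dif_pos hex]
  exact hex.choose_spec

theorem IsLpIdeal.quasiContinuous_comp_coe (h : IsLpIdeal p 𝓘 N) {g : (X →L[ℂ] X) → ℂ}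
    (hg : Continuous g) : QuasiContinuous N fun L : 𝓘 => g L := by
  intro L ε hε
  obtain ⟨δ, hδ, H⟩ := Metric.continuous_iff.1 hg L ε hε
  refine ⟨δ, hδ, fun K hK => ?_⟩
  rw [← dist_eq_norm]
  exact H K ((dist_eq_norm _ _).trans_lt ((h.opNorm_le (K - L)).trans_lt hK))

theorem IsLpIdeal.norm_mul_right_le (h : IsLpIdeal p 𝓘 N) (L : 𝓘) (B : X →L[ℂ] X) :
    N ⟨(L : X →L[ℂ] X) * B, h.mul_right_mem L B⟩ ≤ ‖B‖ * N L := by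
  have e := h.norm_mul_mul_le 1 L B
  simp only [one_mul] at e
  refine e.trans ?_
  rw [mul_comm]
  gcongr
  exact mul_le_of_le_one_left (h.quasiNorm.nonneg L) ContinuousLinearMap.norm_id_le

theorem IsLpIdeal.norm_mul_left_le (h : IsLpIdeal p 𝓘 N) (B : X →L[ℂ] X) (L : 𝓘) :
    N ⟨B * (L : X →L[ℂ] X), h.mul_left_mem B L⟩ ≤ ‖B‖ * N L := by
  have e := h.norm_mul_mul_le B L 1
  simp only [mul_one] at e
  refine e.trans (mul_le_of_le_one_right ?_ ContinuousLinearMap.norm_id_le)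
  exact mul_nonneg (norm_nonneg B) (h.quasiNorm.nonneg L)

theorem IsLpIdeal.regDet_mul_comm [CompleteSpace X] (hp : 0 < p) (h : IsLpIdeal p 𝓘 N) (L : 𝓘)
    (B : X →L[ℂ] X) :
    regDet p 𝓘 N ⟨(L : X →L[ℂ] X) * B, h.mul_right_mem L B⟩ =
      regDet p 𝓘 N ⟨B * (L : X →L[ℂ] X), h.mul_left_mem B L⟩ := by
  have hD := h.isRegDet_regDet hp
  refine congrFun (QuasiContinuous.eq_of_dense h.dense'
    (hD.continuous.comp (φ := fun L => ⟨(L : X →L[ℂ] X) * B, h.mul_right_mem L B⟩) (K := ‖B‖)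
      (fun x y => ?_) h.quasiNorm)
    (hD.continuous.comp (φ := fun L => ⟨B * (L : X →L[ℂ] X), h.mul_left_mem B L⟩) (K := ‖B‖)
      (fun x y => ?_) h.quasiNorm) fun F hF => ?_) L
  · exact (congrArg N (Subtype.ext (sub_mul _ _ _).symm)).trans_le (h.norm_mul_right_le (x - y) B)
  · exact (congrArg N (Subtype.ext (mul_sub _ _ _).symm)).trans_le (h.norm_mul_left_le B (x - y))
  · rw [hD.extends_fin _ (FiniteRank.mul_right hF B), hD.extends_fin _ (FiniteRank.mul_left hF B)]
    exact FiniteRank.regDetFin_mul_comm p hF B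

/-! ### The product formula -/

/-- Noncommutative telescoping. For `H - L = F (1 - L)` every summand has finite rank, and cyclicity
of the trace brings `F` to the front. -/
theorem pow_eq_pow_add_sum {R : Type*} [Ring R] (H L : R) (k : ℕ) :
    H ^ k = L ^ k + ∑ m ∈ Finset.range k, H ^ (k - 1 - m) * ((H - L) * L ^ m) := by
  induction k with
  | zero => simp
  | succ k ih =>
    rw [Finset.sum_range_succ, Nat.add_sub_cancel, Nat.sub_self, pow_zero, one_mul]
    have e : ∑ m ∈ Finset.range k, H ^ (k - m) * ((H - L) * L ^ m) =
        H * ∑ m ∈ Finset.range k, H ^ (k - 1 - m) * ((H - L) * L ^ m) := by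
      rw [Finset.mul_sum]
      refine Finset.sum_congr rfl fun m hm => ?_
      rw [← mul_assoc H, ← pow_succ']
      have := Finset.mem_range.1 hm
      rw [show k - 1 - m + 1 = k - m by omega]
    rw [e, ← sub_eq_iff_eq_add'.2 ih, mul_sub, ← pow_succ', sub_mul, ← pow_succ',
      sub_add_sub_cancel, add_sub_cancel]

theorem FiniteRank.tr_pow_eq_add_sum {F L : X →L[ℂ] X} (hF : FiniteRank F) (hL : FiniteRank L)
    (k : ℕ) (hk : 1 ≤ k) :
    tr ((F + L - F * L) ^ k) = tr (L ^ k) + ∑ m ∈ Finset.range k,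
      tr (F * (1 - L) * L ^ m * (F + L - F * L) ^ (k - 1 - m)) := by
  set H := F + L - F * L with hH
  have hsub : H - L = F * (1 - L) := by rw [hH]; noncomm_ring
  obtain ⟨j, rfl⟩ : ∃ j, k = j + 1 := ⟨k - 1, by omega⟩
  have hs := FiniteRank.tr_sum (Finset.range (j + 1))
    (f := fun m => H ^ (j + 1 - 1 - m) * ((H - L) * L ^ m)) fun m _ => by
      rw [hsub]
      exact ((hF.mul_right _).mul_right _).mul_left _
  conv_lhs => rw [pow_eq_pow_add_sum H L]
  rw [(hL.pow_succ j).tr_add hs.1, hs.2]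
  congr 1
  refine Finset.sum_congr rfl fun m _ => ?_
  rw [hsub, ((hF.mul_right _).mul_right _).tr_mul_comm]

theorem FiniteRank.regDetFin_mul {F L : X →L[ℂ] X} (hF : FiniteRank F) (hL : FiniteRank L) :
    regDetFin p (F + L - F * L) = detOneSub F * regDetFin p L *
      Complex.exp (∑ k ∈ Finset.Ico 1 ⌈p⌉₊, ∑ m ∈ Finset.range k,
        tr (F * (1 - L) * L ^ m * (F + L - F * L) ^ (k - 1 - m)) / (k : ℂ)) := by
  rw [regDetFin, hF.detOneSub_mul hL, regDetFin, mul_assoc, mul_assoc, mul_assoc,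
    ← Complex.exp_add, ← Finset.sum_add_distrib]
  refine congrArg (fun w => detOneSub F * (detOneSub L * Complex.exp w))
    (Finset.sum_congr rfl fun k hk => ?_)
  rw [hF.tr_pow_eq_add_sum hL k (Finset.mem_Ico.1 hk).1, ← Finset.sum_div, add_div]

theorem IsLpIdeal.regDet_mul [CompleteSpace X] (hp : 0 < p) (h : IsLpIdeal p 𝓘 N) (L : 𝓘)
    {F : X →L[ℂ] X} (hF : FiniteRank F) :
    regDet p 𝓘 N ⟨1 - (1 - F) * (1 - (L : X →L[ℂ] X)), h.one_sub_mul_mem hF L⟩ =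
      detOneSub F * regDet p 𝓘 N L *
        Complex.exp (∑ k ∈ Finset.Ico 1 ⌈p⌉₊, ∑ m ∈ Finset.range k,
          tr (F * (1 - (L : X →L[ℂ] X)) * (L : X →L[ℂ] X) ^ m *
            (F + (L : X →L[ℂ] X) - F * (L : X →L[ℂ] X)) ^ (k - 1 - m)) / (k : ℂ)) := by
  have hD := h.isRegDet_regDet hp
  have hg : Continuous fun L : X →L[ℂ] X => Complex.exp (∑ k ∈ Finset.Ico 1 ⌈p⌉₊,
      ∑ m ∈ Finset.range k, tr (F * (1 - L) * L ^ m * (F + L - F * L) ^ (k - 1 - m)) / (k : ℂ)) := by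
    refine Complex.continuous_exp.comp (continuous_finsetSum _ fun k _ =>
      continuous_finsetSum _ fun m _ => Continuous.div_const ?_ _)
    -- Each trace has the form `tr (F A)` with `F` fixed and `A` polynomial in `L`, so it is
    -- continuous in operator norm.
    simp_rw [mul_assoc F]
    exact hF.continuous_tr_mul.comp (by fun_prop)
  have hc : QuasiContinuous N fun _ : 𝓘 => detOneSub F := h.quasiContinuous_comp_coe continuous_const
  refine congrFun (QuasiContinuous.eq_of_dense h.dense'
    (hD.continuous.comp (φ := fun L => ⟨1 - (1 - F) * (1 - (L : X →L[ℂ] X)),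
      h.one_sub_mul_mem hF L⟩) (K := ‖1 - F‖) (fun x y => ?_) h.quasiNorm)
    ((hc.mul h.quasiNorm hD.continuous).mul h.quasiNorm (h.quasiContinuous_comp_coe hg))
    fun K hK => ?_) L
  · refine (le_of_eq ?_).trans (h.norm_mul_left_le (1 - F) (x - y))
    congr 1
    refine Subtype.ext ?_
    change 1 - (1 - F) * (1 - (x : X →L[ℂ] X)) - (1 - (1 - F) * (1 - (y : X →L[ℂ] X))) =
      (1 - F) * ((x : X →L[ℂ] X) - y)
    noncomm_ring
  · have e : 1 - (1 - F) * (1 - (K : X →L[ℂ] X)) = F + K - F * K := by noncomm_ring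
    have hH : FiniteRank (1 - (1 - F) * (1 - (K : X →L[ℂ] X))) := by
      rw [e]
      exact (hF.add hK).sub (hF.mul_right _)
    rw [hD.extends_fin _ hH, hD.extends_fin K hK]
    exact (congrArg (regDetFin p) e).trans (hF.regDetFin_mul hK)

/-! ### Nonvanishing and invertibility -/

theorem IsLpIdeal.exists_regDet_ne_zero_of_lt [CompleteSpace X] (hp : 0 < p)
    (h : IsLpIdeal p 𝓘 N) : ∃ δ > 0, ∀ L : 𝓘, N L < δ → regDet p 𝓘 N L ≠ 0 := by
  have hD := h.isRegDet_regDet hp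
  obtain ⟨q, hq, htri⟩ := h.quasiNorm.quasi_triangle
  obtain ⟨γ, hγ, hle⟩ := h.exists_eigenvalueLpNorm_le
  have hq0 : 0 < q := by linarith
  -- This radius keeps the approximants of `L` at `N F ≤ 1/2`, where the lower bound is uniform; a
  -- zero at `L` would push them below it.
  refine ⟨1 / (4 * q), by positivity, fun L hL h0 => ?_⟩
  obtain ⟨δ, hδ, H⟩ := hD.continuous L _ (Real.exp_pos (-(2 * (γ * (1 / 2)) ^ p)))
  obtain ⟨F, hF, hFL⟩ := h.dense L (min δ (1 / (4 * q))) (by positivity)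
  have hNF : N F ≤ 1 / 2 := by
    have := htri (F - L) L
    rw [sub_add_cancel] at this
    have h₁ := hFL.trans_le (min_le_right _ _)
    calc N F ≤ q * (N (F - L) + N L) := this
      _ ≤ q * (1 / (4 * q) + 1 / (4 * q)) := by gcongr
      _ = 1 / 2 := by field_simp; norm_num
  have h₂ := H F (hFL.trans_le (min_le_left _ _))
  rw [h0, sub_zero, hD.extends_fin F hF] at h₂
  exact h₂.not_ge (hF.exp_neg_le_norm_regDetFin hp ((h.opNorm_le F).trans hNF) (by positivity)
    (hle F _ hNF))

theorem IsLpIdeal.regDet_ne_zero_iff [CompleteSpace X] (hp : 0 < p) (h : IsLpIdeal p 𝓘 N)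
    (L : 𝓘) : regDet p 𝓘 N L ≠ 0 ↔ IsUnit (1 - (L : X →L[ℂ] X)) := by
  obtain ⟨δ, hδ, hne⟩ := h.exists_regDet_ne_zero_of_lt hp
  -- Closeness `δ` makes the determinant at `L - F₀` nonzero; closeness `1` makes `I - (L - F₀)`
  -- invertible by the Neumann series.
  obtain ⟨F₀, hF₀, hF₀L⟩ := h.dense L (min δ 1) (by positivity)
  rw [h.quasiNorm.map_sub_rev] at hF₀L
  have hK := hne (L - F₀) (hF₀L.trans_le (min_le_left _ _))
  obtain ⟨u, hu⟩ : IsUnit (1 - ((L - F₀ : 𝓘) : X →L[ℂ] X)) :=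
    isUnit_one_sub_of_norm_lt_one ((h.opNorm_le _).trans_lt (hF₀L.trans_le (min_le_right _ _)))
  obtain ⟨v, hv⟩ : ∃ v : X →L[ℂ] X, v = ↑u⁻¹ := ⟨_, rfl⟩
  have hvu : v * (1 - ((L - F₀ : 𝓘) : X →L[ℂ] X)) = 1 := by rw [hv, ← hu, Units.inv_mul]
  have hF : FiniteRank ((F₀ : X →L[ℂ] X) * v) := hF₀.mul_right v
  have e : (1 - (F₀ : X →L[ℂ] X) * v) * (1 - ((L - F₀ : 𝓘) : X →L[ℂ] X)) = 1 - L := by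
    rw [sub_mul, mul_assoc, hvu, one_mul, mul_one, Submodule.coe_sub]
    abel
  have e' : (⟨_, h.one_sub_mul_mem hF (L - F₀)⟩ : 𝓘) = L := by
    refine Subtype.ext ?_
    change 1 - (1 - (F₀ : X →L[ℂ] X) * v) * (1 - ((L - F₀ : 𝓘) : X →L[ℂ] X)) = L
    rw [e, sub_sub_cancel]
  have key := h.regDet_mul hp (L - F₀) hF
  rw [e'] at key
  have hiff : IsUnit (1 - (L : X →L[ℂ] X)) ↔ detOneSub ((F₀ : X →L[ℂ] X) * v) ≠ 0 := by
    rw [← e, ← hu, Units.isUnit_mul_units, hF.isUnit_one_sub_iff]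
  rw [hiff, key]
  exact ⟨fun h' h0 => h' (by rw [h0, zero_mul, zero_mul]),
    fun h' => mul_ne_zero (mul_ne_zero h' hK) (Complex.exp_ne_zero _)⟩

end RegDet

end

theorem proposition4p7 {X : Type*} [NormedAddCommGroup X] [NormedSpace ℂ X] [CompleteSpace X]
    {p : ℝ} (hp : 0 < p) (𝓘 : Submodule ℂ (X →L[ℂ] X)) (N : 𝓘 → ℝ)
    (h𝓘 : RegDet.IsLpIdeal p 𝓘 N) :
    -- the regularized determinant is well defined
    (∃! D : 𝓘 → ℂ, RegDet.IsRegDet p 𝓘 N D) ∧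
    -- `det (I - LB) = det (I - BL)`
    (∀ (L : 𝓘) (B : X →L[ℂ] X),
      RegDet.regDet p 𝓘 N ⟨(L : X →L[ℂ] X) * B, h𝓘.mul_right_mem L B⟩ =
        RegDet.regDet p 𝓘 N ⟨B * (L : X →L[ℂ] X), h𝓘.mul_left_mem B L⟩) ∧
    -- the product formula, with `H = F + L - FL`, so that `(I - F)(I - L) = I - H`
    (∀ (L : 𝓘) (F : X →L[ℂ] X) (hF : RegDet.FiniteRank F) (H : X →L[ℂ] X),
      H = F + (L : X →L[ℂ] X) - F * (L : X →L[ℂ] X) →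
      RegDet.regDet p 𝓘 N
          ⟨1 - (1 - F) * (1 - (L : X →L[ℂ] X)), h𝓘.one_sub_mul_mem hF L⟩ =
        RegDet.detOneSub F * RegDet.regDet p 𝓘 N L *
          Complex.exp (∑ k ∈ Finset.Ico 1 ⌈p⌉₊, ∑ m ∈ Finset.range k,
            RegDet.tr (F * (1 - (L : X →L[ℂ] X)) * (L : X →L[ℂ] X) ^ m * H ^ (k - 1 - m)) /
              (k : ℂ))) ∧
    -- `det (I - L) ≠ 0` if and only if `I - L` is invertible in `B(X)`
    (∀ L : 𝓘, RegDet.regDet p 𝓘 N L ≠ 0 ↔ IsUnit (1 - (L : X →L[ℂ] X))) := by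
  refine ⟨h𝓘.existsUnique_isRegDet hp, h𝓘.regDet_mul_comm hp, ?_, h𝓘.regDet_ne_zero_iff hp⟩
  rintro L F hF _ rfl
  exact h𝓘.regDet_mul hp L hF
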